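/- **Setting.** Let $k$ be a perfect field of characteristic $p>0$, $N$ a lattice (a free abelian group of finite rank), $M=\operatorname{Hom}(N,\mathbb Z)$, and $\sigma\subset N_{\mathbb R}$ a full-dimensional strongly convex rational polyhedral cone with primitive generators $v_1,\dots,v_r\in N$. Let $\sigma^\vee\subset M_{\mathbb R}$ be the dual cone, $S=\sigma^\vee\cap M$, $R=k[S]$ with monomials $\chi^u$ ($u\in S$), and let $\mathfrak m=(\chi^u : u\in S\setminus\{0\})$ be the homogeneous maximal ideal. Let $D_i$ be the torus-invariant prime divisor of $\operatorname{Spec} R$ corresponding to $v_i$, with ideal $(\chi^u : u\in S,\ u\cdot v_i\neq 0)$, and let $D=\sum_i a_iD_i$ be an effective torus-invariant $\mathbb Q$-divisor ($0\le a_i\in\mathbb Q$). **Notation.** For an effective integral Weil divisor $E$ on $\operatorname{Spec} R$ put $R(E)=\{f\in\operatorname{Frac} R : f=0 \text{ or } \operatorname{div} f+E\ge 0\}$. For an $R$-module $W$, $F^e_*W$ is the abelian group $W$ on which $r\in R$ acts as $r^{p^e}$, and $F^e_*R$ is identified with $R^{1/p^e}$. Put $$I_e(E)=\{r\in R : \varphi(F^e_*r)\in\mathfrak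 m \text{ for all } \varphi\in\operatorname{Hom}_R(F^e_*R(E),R)\},\qquad I_e^D=I_e(\lceil (p^e-1)D\rceil),$$ and $s(R,D)=\lim_{e\to\infty} \ell_R(R/I_e^D)/p^{e\dim R}$. For a tuple $c=(c_i)$ of rationals put $P_\sigma^{c}=\{w\in M_{\mathbb R} : 0\le w\cdot v_i<1-c_i \text{ for all } i\}$, and write $P_\sigma^D=P_\sigma^{(a_i)}$. **Theorem.** 1. Let $e\ge 0$ be such that $p^eD$ is integral. Then $F^e_*I_e(p^eD)$ is generated, as an $R$-submodule of $F^e_*R=R^{1/p^e}$ and also as an ideal of this ring, by the monomials $\chi^{w}$ with $w\in(\sigma^\vee\setminus P_\sigma^D)\cap\frac1{p^e}M$. If moreover $a_i<1$ for all $i$, the same holds for $F^e_*I_e^D$. 2. For every $e\ge 0$ (and arbitrary $a_i\ge 0$), $F^e_*I_e^D$ is generated, in the same two senses, by the monomials $\chi^w$ with $w\in(\sigma^\vee\setminus P_\sigma^{c})\cap\frac1{p^e}M$, where $c_i=\lceil(p^e-1)a_i\rceil/p^e$. 3. The limit $s(R,D)$ exists and $s(R,D)=\operatorname{Vol}(P_\sigma^D)<\infty$,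 where the volume is normalized so that a fundamental parallelepiped of $M$ has volume $1$. -/

import Mathlib

open scoped TensorProduct ENNReal Topology

noncomputable section

/-! ### Frobenius push-forward -/

/-- The Frobenius push-forward `F^e_* W` of an `R`-module `W`: the same abelian group, on which
`r : R` acts as `r ^ (p ^ e)`. For `R` reduced, `F^e_* R` is the module `R^{1/p^e}`. -/
def FrobPush (_R : Type*) (_p _e : ℕ) (W : Type*) : Type _ := W

namespace FrobPush

/-- The underlying abelian group of `F^e_* W` is that of `W`. -/
instance instAddCommGroup {R : Type*} {p e : ℕ} {W : Type*} [AddCommGroup W] :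
    AddCommGroup (FrobPush R p e W) := inferInstanceAs (AddCommGroup W)

/-- The identity map `W → F^e_* W`, `w ↦ F^e_* w` (also written `w ↦ w^{1/p^e}`). -/
def of (R : Type*) (p e : ℕ) {W : Type*} [AddCommGroup W] : W ≃+ FrobPush R p e W :=
  AddEquiv.refl W

/-- The action of `R` through the `e`-th iterate of Frobenius. -/
instance instModule {R : Type*} [CommRing R] {p e : ℕ} [ExpChar R p]
    {W : Type*} [AddCommGroup W] [Module R W] : Module R (FrobPush R p e W) :=
  Module.compHom W (iterateFrobenius R p e)

theorem smul_of {R : Type*} [CommRing R] {p e : ℕ} [ExpChar R p]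
    {W : Type*} [AddCommGroup W] [Module R W] (r : R) (w : W) :
    r • of R p e w = of R p e (r ^ p ^ e • w) := rfl

/-- Multiplication by `s^{1/p^e}` on `F^e_* W`. -/
def mulRoot {R : Type*} [CommRing R] (p e : ℕ) [ExpChar R p]
    (W : Type*) [AddCommGroup W] [Module R W] (s : R) :
    FrobPush R p e W →ₗ[R] FrobPush R p e W where
  toFun x := of R p e (s • (of R p e).symm x)
  map_add' x y := by simp
  map_smul' r x := by
    obtain ⟨w, rfl⟩ := (of R p e).surjective x
    simp [smul_of, smul_comm s]

/-- For an ideal `I` of `R`, the `R`-submodule `F^e_* I` of `F^e_* R`. -/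
def ideal {R : Type*} [CommRing R] (p e : ℕ) [ExpChar R p] (I : Ideal R) :
    Submodule R (FrobPush R p e R) where
  carrier := {x | (of R p e).symm x ∈ I}
  zero_mem' := by simp
  add_mem' {x y} hx hy := by
    simp only [Set.mem_ofPred_eq, map_add] at *
    exact I.add_mem hx hy
  smul_mem' r x hx := by
    obtain ⟨w, rfl⟩ := (of R p e).surjective x
    simp only [Set.mem_ofPred_eq, smul_of, AddEquiv.symm_apply_apply] at *
    exact I.smul_mem _ hx

end FrobPush

/-! ### Weil divisors and the F-signature of a pair -/

/-- Prime (Weil) divisors on `Spec R`: the prime ideals of height one. -/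
def PrimeDivisor (R : Type*) [CommRing R] : Type _ :=
  {Q : PrimeSpectrum R // Q.asIdeal.height = 1}

/-- The order of vanishing along `Q` of an element of `R`, i.e. the length of `R_Q / a R_Q`. -/
def PrimeDivisor.ord {R : Type*} [CommRing R] (Q : PrimeDivisor R) (a : R) : ℕ∞ :=
  Ring.ord (Localization.AtPrime Q.1.asIdeal) (algebraMap R _ a)

/-- The order along `Q` of a nonzero `f = a / b` of the fraction field of a Noetherian domain:
`ord_Q a - ord_Q b`. It does not depend on the chosen representation. -/
def PrimeDivisor.ordFrac {R : Type*} [CommRing R] (Q : PrimeDivisor R) (f : FractionRing R) : ℤ :=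
  ((Q.ord (IsLocalization.sec (nonZeroDivisors R) f).1).toNat : ℤ) -
    ((Q.ord (IsLocalization.sec (nonZeroDivisors R) f).2).toNat : ℤ)

/-- `R(E) = {f ∈ Frac R : f = 0 or div f + E ≥ 0}`. For a normal Noetherian domain the set of
generators below, together with `0`, is already a submodule; taking its span makes the definition
meaningful before normality is known. -/
def divisorModule {R : Type*} [CommRing R] (E : PrimeDivisor R → ℤ) :
    Submodule R (FractionRing R) :=
  Submodule.span R {f | f ≠ 0 ∧ ∀ Q : PrimeDivisor R, 0 ≤ Q.ordFrac f + E Q}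

/-- `Hom_R(F^e_* R(E), R)` viewed inside `Hom_R(F^e_* R, R)` by restriction along `R ⊆ R(E)`
(`E` effective): the maps `ψ : F^e_* R → R` that extend to `F^e_* R(E)`. -/
def twistedHoms {R : Type*} [CommRing R] (p e : ℕ) [ExpChar R p] (E : PrimeDivisor R → ℤ) :
    Set (FrobPush R p e R →ₗ[R] R) :=
  {ψ | ∃ φ : FrobPush R p e (divisorModule E) →ₗ[R] R,
    ∀ (r : R) (x : divisorModule E), (x : FractionRing R) = algebraMap R (FractionRing R) r →
      φ (FrobPush.of R p e x) = ψ (FrobPush.of R p e r)}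

/-- The ideal `{r ∈ R : φ(r^{1/p^e}) ∈ m for all φ ∈ Hom_R(R(E)^{1/p^e}, R)}`. -/
def splittingIdeal {R : Type*} [CommRing R] (p e : ℕ) [ExpChar R p] (m : Ideal R)
    (E : PrimeDivisor R → ℤ) : Ideal R where
  carrier := {r | ∀ ψ ∈ twistedHoms p e E, ψ (FrobPush.of R p e r) ∈ m}
  zero_mem' ψ _ := by simp
  add_mem' {r s} hr hs ψ hψ := by
    rw [map_add, map_add]
    exact m.add_mem (hr ψ hψ) (hs ψ hψ)
  smul_mem' s r hr ψ hψ := by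
    obtain ⟨φ, hφ⟩ := hψ
    refine hr (ψ ∘ₗ FrobPush.mulRoot p e R s)
      ⟨φ ∘ₗ FrobPush.mulRoot p e (divisorModule E) s, fun t x hx => ?_⟩
    refine hφ (s • t) (s • x) ?_
    simp [hx, Algebra.smul_def]

/-- The ideal `I_e^D` of a `ℚ`-divisor `D`, defined with the integral divisor `⌈(p^e - 1) D⌉`. -/
def pairIdeal {R : Type*} [CommRing R] (p e : ℕ) [ExpChar R p] (m : Ideal R)
    (D : PrimeDivisor R → ℚ) : Ideal R :=
  splittingIdeal p e m fun Q => ⌈((p : ℚ) ^ e - 1) * D Q⌉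

/-- `s` is the F-signature `s(R, D) = lim_e l(R / I_e^D) / p^{ed}`, where `d = dim R`. -/
def IsPairFSignature {R : Type*} [CommRing R] (p : ℕ) [ExpChar R p] (m : Ideal R)
    (D : PrimeDivisor R → ℚ) (s : ℝ≥0∞) : Prop :=
  ∃ d : ℕ, ringKrullDim R = d ∧
    Filter.Tendsto
      (fun e : ℕ => (Module.length R (R ⧸ pairIdeal p e m D) : ℝ≥0∞) / (p : ℝ≥0∞) ^ (e * d))
      Filter.atTop (𝓝 s)

/-! ### Affine toric varieties -/

/-- `v` is the family of primitive generators of the rational polyhedral cone `σ ⊆ N_ℝ`: a minimal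
family of generators consisting of vectors of `N` that are primitive. -/
structure IsPrimitiveGenerators {N : Type*} [AddCommGroup N] {ι : Type*}
    (σ : PointedCone ℝ (ℝ ⊗[ℤ] N)) (v : ι → N) : Prop where
  hull_eq : σ = PointedCone.hull ℝ (Set.range fun i => (1 : ℝ) ⊗ₜ[ℤ] v i)
  minimal : ∀ i, (1 : ℝ) ⊗ₜ[ℤ] v i ∉
    PointedCone.hull ℝ ((fun j => (1 : ℝ) ⊗ₜ[ℤ] v j) '' {j | j ≠ i})
  primitive : ∀ (i : ι) (c : ℤ) (w : N), v i = c • w → IsUnit c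

/-- The dual cone `σ^∨` in `M_ℝ = (N_ℝ)^*`. -/
def dualCone {N : Type*} [AddCommGroup N] (σ : PointedCone ℝ (ℝ ⊗[ℤ] N)) :
    PointedCone ℝ (Module.Dual ℝ (ℝ ⊗[ℤ] N)) :=
  PointedCone.dual (Module.Dual.eval ℝ (ℝ ⊗[ℤ] N)) σ

/-- The semigroup `S = σ^∨ ∩ M`, where `M = N^*`. -/
def toricSemigroup {N : Type*} [AddCommGroup N] (σ : PointedCone ℝ (ℝ ⊗[ℤ] N)) :
    AddSubmonoid (Module.Dual ℤ N) :=
  (dualCone σ).toAddSubmonoid.comap (Module.Dual.baseChange (V := N) ℝ).toAddMonoidHom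

/-- The coordinate ring `R = k[S]`. -/
abbrev ToricRing (k : Type*) [Field k] {N : Type*} [AddCommGroup N]
    (σ : PointedCone ℝ (ℝ ⊗[ℤ] N)) : Type _ :=
  AddMonoidAlgebra k (toricSemigroup σ)

instance ToricRing.instExpChar (k : Type*) [Field k] (p : ℕ) [ExpChar k p]
    {N : Type*} [AddCommGroup N] (σ : PointedCone ℝ (ℝ ⊗[ℤ] N)) : ExpChar (ToricRing k σ) p :=
  expChar_of_injective_algebraMap (algebraMap k (ToricRing k σ)).injective p

/-- The monomial `χ^u`. -/
def toricMonomial (k : Type*) [Field k] {N : Type*} [AddCommGroup N]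
    {σ : PointedCone ℝ (ℝ ⊗[ℤ] N)} (u : toricSemigroup σ) : ToricRing k σ :=
  AddMonoidAlgebra.single u 1

/-- The homogeneous maximal ideal, generated by the monomials `χ^u` with `u ≠ 0`. -/
def toricMaximalIdeal (k : Type*) [Field k] {N : Type*} [AddCommGroup N]
    (σ : PointedCone ℝ (ℝ ⊗[ℤ] N)) : Ideal (ToricRing k σ) :=
  Ideal.span (toricMonomial k '' {u : toricSemigroup σ | u ≠ 0})

/-- The ideal of the torus-invariant prime divisor `D_i` that corresponds to the primitive
generator `w = v_i`: it is generated by the monomials `χ^u` with `u · w ≠ 0`. -/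
def toricPrimeIdeal (k : Type*) [Field k] {N : Type*} [AddCommGroup N]
    (σ : PointedCone ℝ (ℝ ⊗[ℤ] N)) (w : N) : Ideal (ToricRing k σ) :=
  Ideal.span (toricMonomial k '' {u : toricSemigroup σ | (u : Module.Dual ℤ N) w ≠ 0})

open scoped Classical in
/-- The torus-invariant `ℚ`-divisor `∑ a_i D_i`, as the function that sends a prime divisor to its
coefficient. -/
def toricDivisor (k : Type*) [Field k] {N : Type*} [AddCommGroup N]
    (σ : PointedCone ℝ (ℝ ⊗[ℤ] N)) {ι : Type*} [Fintype ι] (v : ι → N) (a : ι → ℚ) :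
    PrimeDivisor (ToricRing k σ) → ℚ :=
  fun Q => ∑ i, if Q.1.asIdeal = toricPrimeIdeal k σ (v i) then a i else 0

/-- The polytope `P_σ^D = {w ∈ M_ℝ : 0 ≤ w · v_i < 1 - a_i for all i}`. -/
def toricPolytope {N : Type*} [AddCommGroup N] {ι : Type*} (v : ι → N) (a : ι → ℚ) :
    Set (Module.Dual ℝ (ℝ ⊗[ℤ] N)) :=
  {w | ∀ i, 0 ≤ w ((1 : ℝ) ⊗ₜ[ℤ] v i) ∧ w ((1 : ℝ) ⊗ₜ[ℤ] v i) < 1 - (a i : ℝ)}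

/-- The characters `u ∈ S` with `u / p^e ∉ P`; the elements `u / p^e` form the set
`(σ^∨ \ P) ∩ (1/p^e) M`. -/
def charactersOutside {N : Type*} [AddCommGroup N] (σ : PointedCone ℝ (ℝ ⊗[ℤ] N)) (p e : ℕ)
    (P : Set (Module.Dual ℝ (ℝ ⊗[ℤ] N))) : Set (toricSemigroup σ) :=
  {u | ((p : ℝ) ^ e)⁻¹ • (u : Module.Dual ℤ N).baseChange ℝ ∉ P}

/-- `F^e_* I` is generated by the monomials `(χ^u)^{1/p^e}`, `u ∈ A`, both as an `R`-submodule of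
`F^e_* R` and as an ideal of the ring `F^e_* R` (the latter means that the `χ^u`, `u ∈ A`, generate
the ideal `I` of `R`). -/
def FrobGeneratedByMonomials {k : Type*} [Field k] {N : Type*} [AddCommGroup N]
    {σ : PointedCone ℝ (ℝ ⊗[ℤ] N)} (p e : ℕ) [ExpChar k p] (I : Ideal (ToricRing k σ))
    (A : Set (toricSemigroup σ)) : Prop :=
  FrobPush.ideal p e I =
      Submodule.span (ToricRing k σ)
        ((fun u => FrobPush.of (ToricRing k σ) p e (toricMonomial k u)) '' A) ∧
    I = Ideal.span (toricMonomial k '' A)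

/-- The volume on `M_ℝ` relative to the lattice `M`, measured in the coordinates of a basis `b` of
`M` (it does not depend on `b`). -/
def latticeVolume {N : Type*} [AddCommGroup N] {n : ℕ}
    (b : Module.Basis (Fin n) ℤ (Module.Dual ℤ N)) (P : Set (Module.Dual ℝ (ℝ ⊗[ℤ] N))) : ℝ≥0∞ :=
  MeasureTheory.volume {x : Fin n → ℝ | ∑ j, x j • (b j).baseChange ℝ ∈ P}

end

/-! Put q = p^e and let E = ∑ c_i D_i with integers c_i ≥ 0. Everything rests on computing I_e(E) as
a monomial ideal: it is spanned by the χ^u with u · v_i ≥ q - c_i for some i (`splittingIdeal_eq`).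

The first ingredient is that R(E) is the span of the characters χ^w with w · v_i ≥ -c_i for all i. A
prime divisor of k[S] whose ideal contains a monomial is some D_i; on the torus, a pole would come
from a prime element of the factorial ring k[M] dividing a reduced denominator. So R(E) lies in
k[M], and the order along D_i is the least value of v_i on the support. Lengths of local rings enter
only through explicit uniformizers (`IsUniformizerAt`).

If u · v_i < q - c_i for all i, the map χ^w ↦ χ^((w-u)/q) (zero when w - u is not divisible by q)
sends R(E) into k[S], because (w-u) · v_i > -q. The constant term of its value at r is the q-th root
of the coefficient of r at u, so no element of I_e(E) involves χ^u. If instead u · v_i ≥ q - c_i for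
some i, choose m with m · v_i = 1. Up to a monomial that is a unit along D_i, χ^u is χ^(qm) times an
element of R(E), so every φ sends χ^u into the prime ideal of D_i, which lies in the maximal ideal.

Parts 1 and 2 then follow by choosing c_i. For part 3, the length of R modulo a cofinite monomial
ideal is the number of missing exponents (`length_quotient_span`), here the lattice points of the
q-th dilation of a polytope with parameters c_i/q → a_i. Squeezing between fixed polytopes with
parameters a_i ± 1/(m+1) gives the volume (`tendsto_ncard_dilatedLatticePoints_of_tendsto`), and dim
R is the rank of M (`ringKrullDim_eq`). -/

noncomputable section

/-! ### Uniformizers at a prime ideal -/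

/-- `π` is a uniformizer of the domain `R` at the prime `Q`: locally at `Q`, every nonzero element
is a unit times a power of `π`. -/
structure IsUniformizerAt {R : Type*} [CommRing R] (Q : Ideal R) (π : R) : Prop where
  mem : π ∈ Q
  ne_zero : π ≠ 0
  exists_eq : ∀ r : R, r ≠ 0 → ∃ s ∉ Q, ∃ d : ℕ, ∃ r' ∉ Q, s * r = π ^ d * r'

namespace IsUniformizerAt

variable {R : Type*} [CommRing R] {Q : Ideal R} [hQ : Q.IsPrime] {π : R}

/-- In `s * q = π ^ d * r'` the exponent cannot be 0, as `r'` is outside `Q`. Thus π generates the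
maximal ideal of the localization. -/
theorem exists_dvd (h : IsUniformizerAt Q π) {q : R} (hq : q ∈ Q) : ∃ s ∉ Q, π ∣ s * q := by
  by_cases h0 : q = 0
  · exact ⟨1, hQ.one_notMem, by simp [h0]⟩
  obtain ⟨s, hs, d, r', hr', he⟩ := h.exists_eq q h0
  refine ⟨s, hs, ?_⟩
  rcases d with _ | d
  · exact absurd (by rw [pow_zero, one_mul] at he; exact he ▸ Q.mul_mem_left s hq) hr'
  · exact ⟨π ^ d * r', by rw [he]; ring⟩

/-- A nonzero prime below `Q` contains some `π ^ d * r'` with `r' ∉ Q`, hence π, hence all of `Q` by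
`exists_dvd`. This bounds the height without a Noetherian hypothesis. -/
theorem eq_bot_of_lt (h : IsUniformizerAt Q π) {P : Ideal R} [hP : P.IsPrime] (hlt : P < Q) :
    P = ⊥ := by
  by_contra hne
  obtain ⟨r, hrP, hr0⟩ := Submodule.exists_mem_ne_zero_of_ne_bot hne
  obtain ⟨s, hs, d, r', hr', he⟩ := h.exists_eq r hr0
  have h1 : π ^ d * r' ∈ P := he ▸ P.mul_mem_left s hrP
  have hπ : π ∈ P := ((hP.mem_or_mem h1).resolve_right fun h => hr' (hlt.le h)) |>
    hP.mem_of_pow_mem d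
  refine hlt.not_ge fun q hq => ?_
  obtain ⟨t, ht, hd⟩ := h.exists_dvd hq
  exact (hP.mem_or_mem (P.mem_of_dvd hd hπ)).resolve_left fun h => ht (hlt.le h)

theorem height_eq_one [IsDomain R] (h : IsUniformizerAt Q π) : Q.height = 1 := by
  apply le_antisymm
  · refine (Ideal.height_le_iff (n := 1)).2 fun P hP hlt => ?_
    rw [h.eq_bot_of_lt hlt, Ideal.height_bot]
    exact_mod_cast zero_lt_one
  · rw [Order.one_le_iff_ne_zero, Ne, Ideal.height_eq_zero_iff_eq_bot]
    rintro rfl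
    exact h.ne_zero (by simpa using h.mem)

theorem ord_self (h : IsUniformizerAt Q π) :
    Ring.ord (Localization.AtPrime Q) (algebraMap R _ π) = 1 := by
  have hspan : Ideal.span {algebraMap R (Localization.AtPrime Q) π} =
      IsLocalRing.maximalIdeal (Localization.AtPrime Q) := by
    rw [← Localization.AtPrime.map_eq_maximalIdeal]
    apply le_antisymm
    · rw [Ideal.span_singleton_le_iff_mem]
      exact Ideal.mem_map_of_mem _ h.mem
    · rw [Ideal.map_le_iff_le_comap]
      intro q hq
      obtain ⟨s, hs, hd⟩ := h.exists_dvd hq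
      have hu : IsUnit (algebraMap R (Localization.AtPrime Q) s) :=
        IsLocalization.map_units _ (⟨s, hs⟩ : Q.primeCompl)
      rw [Ideal.mem_comap, Ideal.mem_span_singleton, ← hu.dvd_mul_left, ← map_mul]
      exact map_dvd _ hd
  rw [Ring.ord, hspan, Module.length_eq_one_iff]
  rw [isSimpleModule_iff_isCoatom]
  exact (IsLocalRing.maximalIdeal.isMaximal _).out

theorem ord_eq [IsDomain R] (h : IsUniformizerAt Q π) {r s r' : R} {d : ℕ} (hs : s ∉ Q) (hr' : r' ∉ Q)
    (he : s * r = π ^ d * r') : Ring.ord (Localization.AtPrime Q) (algebraMap R _ r) = d := by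
  have hu : ∀ x ∉ Q, IsUnit (algebraMap R (Localization.AtPrime Q) x) := fun x hx =>
    IsLocalization.map_units _ (⟨x, hx⟩ : Q.primeCompl)
  have h1 := congrArg (fun x => Ring.ord (Localization.AtPrime Q) (algebraMap R _ x)) he
  have hne : algebraMap R (Localization.AtPrime Q) π ≠ 0 := by
    rw [Ne, IsLocalization.to_map_eq_zero_iff _ Q.primeCompl_le_nonZeroDivisors]
    exact h.ne_zero
  simp only [map_mul, Ring.ord_mul_of_isUnit_left (hu s hs),
    Ring.ord_mul_of_isUnit_right (hu r' hr'), map_pow] at h1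
  rw [h1, Ring.ord_pow (mem_nonZeroDivisors_of_ne_zero hne), h.ord_self]
  simp

end IsUniformizerAt

/-! ### Orders of rational functions along prime divisors. -/

theorem PrimeDivisor.ord_mul {R : Type*} [CommRing R] [IsDomain R] (Q : PrimeDivisor R) (a : R)
    {b : R} (hb : b ≠ 0) : Q.ord (a * b) = Q.ord a + Q.ord b := by
  rw [PrimeDivisor.ord, map_mul, Ring.ord_mul, PrimeDivisor.ord, PrimeDivisor.ord]
  apply mem_nonZeroDivisors_of_ne_zero
  rwa [Ne, IsLocalization.to_map_eq_zero_iff _ Q.1.asIdeal.primeCompl_le_nonZeroDivisors]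

theorem PrimeDivisor.ord_eq_zero {R : Type*} [CommRing R] (Q : PrimeDivisor R) {a : R}
    (ha : a ∉ Q.1.asIdeal) : Q.ord a = 0 :=
  Ring.ord_of_isUnit (IsLocalization.map_units _ (⟨a, ha⟩ : Q.1.asIdeal.primeCompl))

/-- If `f = a / b` and the orders of all nonzero elements are finite along `Q`, then
`ord_Q f = ord_Q a - ord_Q b`. -/
theorem PrimeDivisor.ordFrac_eq {R : Type*} [CommRing R] [IsDomain R] (Q : PrimeDivisor R)
    (hfin : ∀ r : R, r ≠ 0 → Q.ord r ≠ ⊤) {f : FractionRing R} {a b : R} (ha : a ≠ 0) (hb : b ≠ 0)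
    (h : f * algebraMap R _ b = algebraMap R _ a) :
    Q.ordFrac f = ((Q.ord a).toNat : ℤ) - ((Q.ord b).toNat : ℤ) := by
  set x := (IsLocalization.sec (nonZeroDivisors R) f).1 with hx
  set y := (IsLocalization.sec (nonZeroDivisors R) f).2 with hy
  have hy0 : (y : R) ≠ 0 := nonZeroDivisors.ne_zero y.2
  have hxy : f * algebraMap R _ (y : R) = algebraMap R _ x := IsLocalization.sec_spec _ f
  have hinj := IsFractionRing.injective R (FractionRing R)
  have he : x * b = a * y := by
    apply hinj
    rw [map_mul, map_mul, ← hxy, ← h]; ring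
  have hx0 : x ≠ 0 := by
    intro h0
    rw [h0, zero_mul] at he
    exact mul_ne_zero ha hy0 he.symm
  have h2 : Q.ord x + Q.ord b = Q.ord a + Q.ord y := by
    rw [← Q.ord_mul _ hb, he, Q.ord_mul _ hy0]
  have h3 := congrArg ENat.toNat h2
  rw [ENat.toNat_add (hfin _ hx0) (hfin _ hb), ENat.toNat_add (hfin _ ha) (hfin _ hy0)] at h3
  rw [PrimeDivisor.ordFrac, ← hx, ← hy]
  omega

/-- If `f = a / b` with `a` and `b` invertible at `Q`, then `ord_Q f = 0`. -/
theorem PrimeDivisor.ordFrac_eq_zero {R : Type*} [CommRing R] [IsDomain R] (Q : PrimeDivisor R)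
    {f : FractionRing R} {a b : R} (ha : a ∉ Q.1.asIdeal) (hb : b ∉ Q.1.asIdeal)
    (h : f * algebraMap R _ b = algebraMap R _ a) : Q.ordFrac f = 0 := by
  set x := (IsLocalization.sec (nonZeroDivisors R) f).1 with hx
  set y := (IsLocalization.sec (nonZeroDivisors R) f).2 with hy
  have hxy : f * algebraMap R _ (y : R) = algebraMap R _ x := IsLocalization.sec_spec _ f
  have he : x * b = y * a := by
    apply IsFractionRing.injective R (FractionRing R)
    rw [map_mul, map_mul, ← hxy, ← h]; ring
  have hne : ∀ {c : R}, c ∉ Q.1.asIdeal → c ≠ 0 := fun hc h0 => hc (h0 ▸ zero_mem _)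
  -- Orders along `Q` may be infinite here; the equality holds already in `ℕ∞`, with nothing to
  -- cancel, since `a` and `b` have order 0.
  have h2 : Q.ord x = Q.ord y := by
    have := congrArg Q.ord he
    rwa [Q.ord_mul _ (hne hb), Q.ord_mul _ (hne ha), Q.ord_eq_zero hb, Q.ord_eq_zero ha,
      add_zero, add_zero] at this
  rw [PrimeDivisor.ordFrac, ← hx, ← hy, h2, sub_self]

end

noncomputable section

/-! ### The algebra of a submonoid of a group -/

namespace SubmonoidAlgebra

open AddMonoidAlgebra

variable {k M : Type*} [Field k] [AddCommGroup M] (S : AddSubmonoid M)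

instance instUniqueSums [UniqueSums M] : UniqueSums S :=
  UniqueSums.of_injective_addHom S.subtype.toAddHom Subtype.val_injective inferInstance

variable (k) in
/-- The inclusion `k[S] → k[M]`. -/
def incl : AddMonoidAlgebra k S →+* AddMonoidAlgebra k M := mapDomainRingHom k S.subtype

theorem incl_injective : Function.Injective (incl k S) :=
  mapDomain_injective Subtype.val_injective

variable {S}

@[simp] theorem incl_single (u : S) (c : k) : incl k S (single u c) = single (u : M) c :=
  mapDomain_single

@[simp] theorem coeff_incl (r : AddMonoidAlgebra k S) (u : S) :
    (incl k S r).coeff (u : M) = r.coeff u :=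
  Finsupp.mapDomain_apply Subtype.val_injective _ _

theorem coeff_incl_of_notMem (r : AddMonoidAlgebra k S) {u : M} (hu : u ∉ S) :
    (incl k S r).coeff u = 0 :=
  Finsupp.mapDomain_of_notMem_range _ _ (by simpa using hu)

theorem mem_of_mem_support_incl {r : AddMonoidAlgebra k S} {u : M}
    (hu : u ∈ (incl k S r).coeff.support) : u ∈ S := by
  by_contra h
  exact Finsupp.mem_support_iff.1 hu (coeff_incl_of_notMem r h)

theorem exists_incl_eq {x : AddMonoidAlgebra k M} (hx : ∀ u ∈ x.coeff.support, u ∈ S) :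
    ∃ r, incl k S r = x :=
  ⟨comapDomain Subtype.val Subtype.val_injective x,
    mapDomain_comapDomain (by simpa [Set.subset_def] using hx) Subtype.val_injective⟩

theorem coeff_single_mul' {G : Type*} [AddCommGroup G] (x : AddMonoidAlgebra k G) (c : k)
    (t u : G) : (single t c * x).coeff u = c * x.coeff (u - t) := by
  conv_lhs => rw [← add_sub_cancel t u]
  exact coeff_single_mul_add x c t (u - t)

/-- An ideal generated by the monomials in an upward closed set consists of the elements supported
in this set. -/
theorem mem_span_single_iff {A : Set S} (hA : ∀ u ∈ A, ∀ s : S, s + u ∈ A)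
    (r : AddMonoidAlgebra k S) :
    r ∈ Ideal.span ((fun u : S => single u (1 : k)) '' A) ↔ ∀ u ∈ r.coeff.support, u ∈ A := by
  have := mem_ideal_span_of'_image (k := k) (s := A) (x := r)
  refine this.trans (forall₂_congr fun u _ => ⟨?_, fun hu => ⟨u, hu, 0, by simp⟩⟩)
  rintro ⟨m, hm, d, rfl⟩
  exact hA m hm d

/-- The ideal generated by the monomials `χ^u` with `ℓ u ≠ 0`. -/
def facetIdeal (k : Type*) [Field k] (S : AddSubmonoid M) (ℓ : M →+ ℤ) :
    Ideal (AddMonoidAlgebra k S) :=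
  Ideal.span ((fun u : S => single u (1 : k)) '' {u | ℓ u ≠ 0})

theorem mem_facetIdeal {ℓ : M →+ ℤ} (hℓ : ∀ u ∈ S, 0 ≤ ℓ u) {r : AddMonoidAlgebra k S} :
    r ∈ facetIdeal k S ℓ ↔ ∀ u ∈ r.coeff.support, ℓ u ≠ 0 := by
  refine mem_span_single_iff (fun u hu s => ?_) r
  have h1 := hℓ _ u.2
  have h2 := hℓ _ s.2
  simp only [Set.mem_ofPred_eq, AddSubmonoid.coe_add, map_add] at hu ⊢
  omega

theorem single_mem_facetIdeal {ℓ : M →+ ℤ} (hℓ : ∀ u ∈ S, 0 ≤ ℓ u) {u : S} :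
    single u (1 : k) ∈ facetIdeal k S ℓ ↔ ℓ u ≠ 0 := by
  rw [mem_facetIdeal hℓ]
  simp

/-- Modulo the ideal, every element is represented by its part on the face ℓ = 0. The product of two
nonzero such parts is nonzero, since k[S] is a domain, and is again supported on the face, so it
lies outside the ideal. -/
theorem isPrime_facetIdeal [UniqueSums M] {ℓ : M →+ ℤ} (hℓ : ∀ u ∈ S, 0 ≤ ℓ u) :
    (facetIdeal k S ℓ).IsPrime := by
  refine Ideal.isPrime_iff.2 ⟨?_, fun {x y} hxy => ?_⟩
  · rw [Ideal.ne_top_iff_one]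
    intro h
    exact single_mem_facetIdeal (k := k) hℓ (u := 0) |>.1 h (by simp)
  by_contra! hne
  have key : ∀ z : AddMonoidAlgebra k S, z ∉ facetIdeal k S ℓ → ∃ z₀, z₀ ≠ 0 ∧
      z - z₀ ∈ facetIdeal k S ℓ ∧ ∀ u ∈ z₀.coeff.support, ℓ u = 0 := by
    intro z hz
    refine ⟨.ofCoeff (z.coeff.filter fun u => ℓ u = 0), ?_, ?_, ?_⟩
    · intro h0
      apply hz
      rw [mem_facetIdeal hℓ]
      intro u hu hu0
      have := congrArg (fun w => w.coeff u) h0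
      simp [hu0] at this
      simp [this] at hu
    · rw [mem_facetIdeal hℓ]
      intro u hu hu0
      simp [hu0] at hu
    · intro u hu
      simp at hu
      exact hu.2
  obtain ⟨x₀, hx0, hx1, hx2⟩ := key x hne.1
  obtain ⟨y₀, hy0, hy1, hy2⟩ := key y hne.2
  have hmem : x₀ * y₀ ∈ facetIdeal k S ℓ := by
    have : x₀ * y₀ = x * y - (x - x₀) * y - x₀ * (y - y₀) := by ring
    rw [this]
    exact sub_mem (sub_mem hxy (Ideal.mul_mem_right _ _ hx1)) (Ideal.mul_mem_left _ _ hy1)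
  apply mul_ne_zero hx0 hy0
  rw [← coeff_eq_zero, ← Finsupp.support_eq_empty, Finset.eq_empty_iff_forall_notMem]
  intro u hu
  refine (mem_facetIdeal hℓ).1 hmem u hu ?_
  classical
  obtain ⟨a, ha, b, hb, rfl⟩ := Finset.mem_add.1 (support_coeff_mul_subset x₀ y₀ hu)
  simp [hx2 a ha, hy2 b hb]

end SubmonoidAlgebra

/-! ### Toric cones -/

/-- `S` is the monoid of lattice points of a full-dimensional strongly convex cone whose facets are
given by the primitive forms `ℓ i`. -/
structure IsToricCone {M ι : Type*} [AddCommGroup M] (S : AddSubmonoid M) (ℓ : ι → M →+ ℤ) :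
    Prop where
  mem_iff : ∀ u, u ∈ S ↔ ∀ i, 0 ≤ ℓ i u
  eq_zero : ∀ u, (∀ i, ℓ i u = 0) → u = 0
  exists_pos : ∃ u, ∀ i, 0 < ℓ i u
  exists_facet : ∀ i, ∃ u, ℓ i u = 0 ∧ ∀ j, j ≠ i → 0 < ℓ j u
  exists_one : ∀ i, ∃ u, ℓ i u = 1

namespace IsToricCone

open AddMonoidAlgebra SubmonoidAlgebra

variable {k M ι : Type*} [Field k] [AddCommGroup M] {S : AddSubmonoid M} {ℓ : ι → M →+ ℤ}

theorem nonneg (h : IsToricCone S ℓ) (i : ι) : ∀ u ∈ S, 0 ≤ ℓ i u :=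
  fun u hu => (h.mem_iff u).1 hu i

/-- A multiple of `v` dominates finitely many vectors along all forms positive on `v`. -/
theorem exists_nsmul_add_nonneg [Fintype ι] (ℓ : ι → M →+ ℤ) (v : M) (F : Finset M) :
    ∃ n : ℕ, ∀ u ∈ F, ∀ i, 0 < ℓ i v → 0 ≤ ℓ i (u + n • v) := by
  refine ⟨∑ u ∈ F, ∑ i, (ℓ i u).natAbs, fun u hu i hi => ?_⟩
  have h1 : (ℓ i u).natAbs ≤ ∑ u ∈ F, ∑ i, (ℓ i u).natAbs :=
    (Finset.single_le_sum (f := fun i => (ℓ i u).natAbs) (fun _ _ => Nat.zero_le _)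
      (Finset.mem_univ i)).trans
      (Finset.single_le_sum (f := fun u => ∑ i, (ℓ i u).natAbs) (fun _ _ => Nat.zero_le _) hu)
  set n := ∑ u ∈ F, ∑ i, (ℓ i u).natAbs
  rw [map_add, map_nsmul, nsmul_eq_mul]
  have h2 : (n : ℤ) ≤ n * ℓ i v := le_mul_of_one_le_right (by positivity) hi
  omega

theorem exists_min (h : IsToricCone S ℓ) (i : ι) {r : AddMonoidAlgebra k S} (hr : r ≠ 0) :
    ∃ d : ℕ, (∀ u ∈ r.coeff.support, (d : ℤ) ≤ ℓ i u) ∧ ∃ u ∈ r.coeff.support, ℓ i u = d := by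
  obtain ⟨u, hu, hmin⟩ := r.coeff.support.exists_min_image (fun u => ℓ i u)
    (Finsupp.support_nonempty_iff.2 (by simpa using hr))
  have := h.nonneg i u u.2
  exact ⟨(ℓ i u).toNat, fun w hw => by simpa [this] using hmin w hw, u, hu,
    by simp [this]⟩

/-- A lattice point on facet i and off all other facets has a monomial that separates the ideals. -/
theorem facetIdeal_injective (h : IsToricCone S ℓ) :
    Function.Injective fun i => facetIdeal k S (ℓ i) := by
  intro i j hij
  by_contra hne
  obtain ⟨m, hm0, hm⟩ := h.exists_facet i
  have hmS : m ∈ S := (h.mem_iff m).2 fun l => by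
    by_cases hl : l = i
    · rw [hl, hm0]
    · exact (hm l hl).le
  have h1 := single_mem_facetIdeal (k := k) (h.nonneg i) (u := ⟨m, hmS⟩)
  have h2 := single_mem_facetIdeal (k := k) (h.nonneg j) (u := ⟨m, hmS⟩)
  simp only at hij
  rw [hij, h2] at h1
  have := hm j (Ne.symm hne)
  simp only [hm0] at h1
  omega

variable [Fintype ι]

/-- A large multiple of a lattice point in the relative interior of facet i raises every other form
and leaves `ℓ i` unchanged. It clears denominators by a monomial that is a unit along D_i. -/
theorem exists_shift (h : IsToricCone S ℓ) (i : ι) (F : Finset M) :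
    ∃ t ∈ S, ℓ i t = 0 ∧ ∀ u ∈ F, 0 ≤ ℓ i u → u + t ∈ S := by
  obtain ⟨m, hm0, hm⟩ := h.exists_facet i
  obtain ⟨n, hn⟩ := exists_nsmul_add_nonneg ℓ m F
  refine ⟨n • m, (h.mem_iff _).2 fun j => ?_, by simp [hm0], fun u hu hui => ?_⟩
  · rw [map_nsmul]
    by_cases hj : j = i
    · simp [hj, hm0]
    · exact nsmul_nonneg (hm j hj).le n
  · refine (h.mem_iff _).2 fun j => ?_
    by_cases hj : j = i
    · subst hj; simpa [hm0] using hui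
    · exact hn u hu j (hm j hj)

theorem exists_shift_all (h : IsToricCone S ℓ) (F : Finset M) : ∃ t ∈ S, ∀ u ∈ F, u + t ∈ S := by
  obtain ⟨m, hm⟩ := h.exists_pos
  obtain ⟨n, hn⟩ := exists_nsmul_add_nonneg ℓ m F
  exact ⟨n • m, (h.mem_iff _).2 fun j => by rw [map_nsmul]; exact nsmul_nonneg (hm j).le n,
    fun u hu => (h.mem_iff _).2 fun j => hn u hu j (hm j)⟩

theorem exists_mem_eq_one (h : IsToricCone S ℓ) (i : ι) : ∃ m ∈ S, ℓ i m = 1 := by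
  obtain ⟨m, hm⟩ := h.exists_one i
  obtain ⟨t, -, ht0, ht⟩ := h.exists_shift i {m}
  exact ⟨m + t, ht m (by simp) (by omega), by simp [hm, ht0]⟩

/-- Every Laurent polynomial is a quotient of an element of `k[S]` by a monomial. -/
theorem exists_single_mul_eq_incl (h : IsToricCone S ℓ) (x : AddMonoidAlgebra k M) :
    ∃ (t : S) (r : AddMonoidAlgebra k S), single (t : M) 1 * x = incl k S r := by
  obtain ⟨t, ht, hF⟩ := h.exists_shift_all x.coeff.support
  obtain ⟨r, hr⟩ := exists_incl_eq (S := S) (x := single t 1 * x) fun u hu => by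
    rw [Finsupp.mem_support_iff, coeff_single_mul', one_mul, ← Finsupp.mem_support_iff] at hu
    simpa using hF _ hu
  exact ⟨⟨t, ht⟩, r, hr.symm⟩

/-- Divide `r` by χ^(d m) and return to k[S] by a shift t along the facet, so s = χ^t. An exponent
where `ℓ i` equals d then gives a term of `r'` on the face, which keeps `r'` out of the ideal. -/
theorem exists_factor (h : IsToricCone S ℓ) {i : ι} {m : S} (hm : ℓ i m = 1)
    {r : AddMonoidAlgebra k S} {d : ℕ} (hd : ∀ u ∈ r.coeff.support, (d : ℤ) ≤ ℓ i u)
    (hd' : ∃ u ∈ r.coeff.support, ℓ i u = d) :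
    ∃ s ∉ facetIdeal k S (ℓ i), ∃ r' ∉ facetIdeal k S (ℓ i), s * r = single m 1 ^ d * r' := by
  classical
  obtain ⟨t, htS, ht0, ht⟩ :=
    h.exists_shift i (r.coeff.support.image fun u : S => (u : M) - d • (m : M))
  obtain ⟨r', hr'⟩ := exists_incl_eq (S := S)
    (x := single (t - d • (m : M)) (1 : k) * incl k S r) fun u hu => by
      rw [Finsupp.mem_support_iff, coeff_single_mul', one_mul, ← Finsupp.mem_support_iff] at hu
      have hS := mem_of_mem_support_incl hu
      have hu' : (⟨_, hS⟩ : S) ∈ r.coeff.support := by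
        rw [Finsupp.mem_support_iff] at hu ⊢
        rwa [← coeff_incl]
      have := ht _ (Finset.mem_image_of_mem _ hu') (by
        have := hd _ hu'
        simp only [map_sub, map_nsmul, hm, nsmul_eq_mul] at this ⊢
        omega)
      convert this using 1
      simp only
      abel
  refine ⟨single ⟨t, htS⟩ 1, ?_, r', ?_, ?_⟩
  · rw [single_mem_facetIdeal (h.nonneg i)]
    simp [ht0]
  · rw [mem_facetIdeal (h.nonneg i)]
    push Not
    obtain ⟨u, hu, hud⟩ := hd'
    have hS : (u : M) - d • (m : M) + t ∈ S :=
      ht _ (Finset.mem_image_of_mem _ hu) (by simp [hm, hud])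
    refine ⟨⟨_, hS⟩, ?_, by simp [hm, hud, ht0]⟩
    rw [Finsupp.mem_support_iff, ← coeff_incl, hr', coeff_single_mul', one_mul]
    have : (u : M) - d • (m : M) + t - (t - d • (m : M)) = u := by abel
    rw [this, coeff_incl]
    exact Finsupp.mem_support_iff.1 hu
  · apply incl_injective S
    rw [map_mul, map_mul, map_pow, hr', incl_single, incl_single, single_pow, ← mul_assoc,
      single_mul_single, one_pow, one_mul]
    congr 2
    simp

theorem isUniformizerAt (h : IsToricCone S ℓ) {i : ι} {m : S} (hm : ℓ i m = 1) :
    IsUniformizerAt (facetIdeal k S (ℓ i)) (single m 1) where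
  mem := (single_mem_facetIdeal (h.nonneg i)).2 (by simp [hm])
  ne_zero := by simp
  exists_eq r hr := by
    obtain ⟨d, hd, hd'⟩ := h.exists_min i hr
    obtain ⟨s, hs, r', hr', he⟩ := h.exists_factor hm hd hd'
    exact ⟨s, hs, d, r', hr', he⟩

variable [UniqueSums M]

variable (k) in
/-- The torus-invariant prime divisor that corresponds to a facet. -/
def facetDivisor (h : IsToricCone S ℓ) (i : ι) : PrimeDivisor (AddMonoidAlgebra k S) :=
  ⟨⟨facetIdeal k S (ℓ i), isPrime_facetIdeal (h.nonneg i)⟩, by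
    obtain ⟨m, hmS, hm⟩ := h.exists_mem_eq_one i
    have := isPrime_facetIdeal (k := k) (h.nonneg i)
    exact (h.isUniformizerAt (k := k) (m := ⟨m, hmS⟩) hm).height_eq_one⟩

/-- The order of vanishing along a facet divisor is the smallest value of the form on the
support. -/
theorem ord_facetDivisor (h : IsToricCone S ℓ) (i : ι) {r : AddMonoidAlgebra k S} {d : ℕ}
    (hd : ∀ u ∈ r.coeff.support, (d : ℤ) ≤ ℓ i u) (hd' : ∃ u ∈ r.coeff.support, ℓ i u = d) :
    (h.facetDivisor k i).ord r = d := by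
  obtain ⟨m, hmS, hm⟩ := h.exists_mem_eq_one i
  have := isPrime_facetIdeal (k := k) (h.nonneg i)
  obtain ⟨s, hs, r', hr', he⟩ := h.exists_factor (m := ⟨m, hmS⟩) hm hd hd'
  exact (h.isUniformizerAt (m := ⟨m, hmS⟩) hm).ord_eq hs hr' he

theorem ord_facetDivisor_ne_top (h : IsToricCone S ℓ) (i : ι) (r : AddMonoidAlgebra k S)
    (hr : r ≠ 0) : (h.facetDivisor k i).ord r ≠ ⊤ := by
  obtain ⟨d, hd, hd'⟩ := h.exists_min i hr
  rw [h.ord_facetDivisor i hd hd']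
  exact ENat.natCast_ne_top d

theorem toNat_ord_single (h : IsToricCone S ℓ) (i : ι) (u : S) :
    (((h.facetDivisor k i).ord (single u 1)).toNat : ℤ) = ℓ i u := by
  have h0 := h.nonneg i u u.2
  rw [h.ord_facetDivisor i (d := (ℓ i u).toNat) (by simp [h0]) (by simp [h0])]
  simp [h0]

/-- A prime divisor whose ideal contains a monomial is a facet divisor. -/
theorem eq_facetDivisor (h : IsToricCone S ℓ) (Q : PrimeDivisor (AddMonoidAlgebra k S)) {u : S}
    (hu : single u 1 ∈ Q.1.asIdeal) : ∃ i, Q = h.facetDivisor k i := by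
  have hQ := Q.1.2
  obtain ⟨i, hi⟩ : ∃ i, facetIdeal k S (ℓ i) ≤ Q.1.asIdeal := by
    -- Otherwise each facet has a monomial off it and outside `Q`. The product χ^t of these is
    -- outside `Q` with t interior, yet a power of χ^t is divisible by χ^u.
    by_contra! hcon
    have : ∀ i, ∃ w : S, ℓ i w ≠ 0 ∧ single w 1 ∉ Q.1.asIdeal := by
      intro i
      by_contra! hall
      refine hcon i (Ideal.span_le.2 ?_)
      rintro _ ⟨w, hw, rfl⟩
      exact hall w hw
    choose w hw0 hwQ using this
    set t : S := ∑ i, w i with ht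
    have htpos : ∀ i, 0 < ℓ i t := by
      intro i
      have h1 : ℓ i (w i) ≤ ∑ j, ℓ i (w j) :=
        Finset.single_le_sum (f := fun j => ℓ i (w j)) (fun j _ => h.nonneg i _ (w j).2)
          (Finset.mem_univ i)
      have h2 := h.nonneg i _ (w i).2
      have h3 := hw0 i
      have h4 : ℓ i t = ∑ j, ℓ i (w j) := by rw [ht]; simp
      omega
    have htQ : single t 1 ∉ Q.1.asIdeal := by
      have : ∀ F : Finset ι, single (∑ i ∈ F, w i) (1 : k) ∉ Q.1.asIdeal := by
        classical
        intro F
        induction F using Finset.induction_on with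
        | empty => exact hQ.one_notMem
        | insert i F hi ih =>
          rw [Finset.sum_insert hi, ← one_mul (1 : k), ← single_mul_single]
          exact fun hmem => (hQ.mem_or_mem hmem).elim (hwQ i) ih
      exact this _
    obtain ⟨n, hn⟩ := exists_nsmul_add_nonneg ℓ (t : M) {-(u : M)}
    have hS : -(u : M) + n • (t : M) ∈ S :=
      (h.mem_iff _).2 fun i => hn _ (by simp) i (htpos i)
    apply htQ
    apply hQ.mem_of_pow_mem n
    have : single t (1 : k) ^ n = single (⟨_, hS⟩ : S) 1 * single u 1 := by
      rw [single_pow, single_mul_single, one_pow, one_mul]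
      congr 1
      ext
      simp
    rw [this]
    exact Q.1.asIdeal.mul_mem_left _ hu
  refine ⟨i, Subtype.ext (PrimeSpectrum.ext ?_)⟩
  by_contra hne
  obtain ⟨m, hmS, hm⟩ := h.exists_mem_eq_one i
  have hP := isPrime_facetIdeal (k := k) (h.nonneg i)
  have h1 := Ideal.height_add_one_le_of_lt_of_isPrime (lt_of_le_of_ne hi (Ne.symm hne))
  rw [Q.2, (h.isUniformizerAt (k := k) (m := ⟨m, hmS⟩) hm).height_eq_one] at h1
  exact absurd h1 (by decide)

end IsToricCone

end

noncomputable section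

/-! ### Laurent polynomials form a factorial ring -/

namespace LaurentAlgebra

open AddMonoidAlgebra

variable {M : Type*} [AddCommGroup M] {n : ℕ} (b : Module.Basis (Fin n) ℤ M)

theorem uniqueSums (b : Module.Basis (Fin n) ℤ M) : UniqueSums M :=
  UniqueSums.of_injective_addHom b.repr.toLinearMap.toAddMonoidHom.toAddHom b.repr.injective
    inferInstance

/-- The embedding of the monoid of exponents of polynomials. -/
def exponentHom : (Fin n →₀ ℕ) →+ M :=
  (b.repr.symm.toLinearMap.toAddMonoidHom).comp
    (Finsupp.mapRange.addMonoidHom (Nat.castAddMonoidHom ℤ))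

theorem exponentHom_injective : Function.Injective (exponentHom b) :=
  b.repr.symm.injective.comp (Finsupp.mapRange_injective _ (by simp) Nat.cast_injective)

theorem exists_add_exponentHom (m : M) : ∃ s t, m + exponentHom b s = exponentHom b t := by
  -- The negative and positive parts of the coordinate vector.
  refine ⟨(b.repr m).mapRange (fun z => (-z).toNat) (by simp),
    (b.repr m).mapRange Int.toNat (by simp), b.repr.injective ?_⟩
  ext i
  simp [exponentHom]
  omega

variable (k : Type*) [Field k]

/-- The embedding of the polynomial ring into the ring of Laurent polynomials. -/
def ofPolynomial : AddMonoidAlgebra k (Fin n →₀ ℕ) →+* AddMonoidAlgebra k M :=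
  mapDomainRingHom k (exponentHom b)

theorem ofPolynomial_injective : Function.Injective (ofPolynomial b k) :=
  mapDomain_injective (exponentHom_injective b)

@[simp] theorem ofPolynomial_single (s : Fin n →₀ ℕ) (c : k) :
    ofPolynomial b k (single s c) = single (exponentHom b s) c := mapDomain_single

theorem exists_mul_ofPolynomial (x : AddMonoidAlgebra k M) :
    ∃ s p, x * ofPolynomial b k (single s 1) = ofPolynomial b k p := by
  induction x using AddMonoidAlgebra.induction_linear with
  | zero => exact ⟨0, 0, by simp⟩
  | add x y hx hy =>
    obtain ⟨s, p, hp⟩ := hx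
    obtain ⟨t, q, hq⟩ := hy
    refine ⟨s + t, p * single t 1 + q * single s 1, ?_⟩
    have hst : (single (s + t) (1 : k)) = single s 1 * single t 1 := by simp
    rw [hst, map_mul, map_add, map_mul, map_mul, ← hp, ← hq]
    ring
  | single m c =>
    obtain ⟨s, t, h⟩ := exists_add_exponentHom b m
    exact ⟨s, single t c, by simp [h]⟩

/-- The Laurent polynomials are a localization of the polynomials. -/
theorem isLocalization :
    @IsLocalization _ _ (MonoidHom.mrange (AddMonoidAlgebra.of k (Fin n →₀ ℕ)))
      (AddMonoidAlgebra k M) _ (ofPolynomial b k).toAlgebra := by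
  let := (ofPolynomial b k).toAlgebra
  refine ⟨?_, ?_, ?_⟩
  · rintro ⟨_, s, rfl⟩
    refine IsUnit.of_mul_eq_one (single (-exponentHom b s.toAdd) 1) ?_
    change ofPolynomial b k (single _ _) * _ = _
    rw [ofPolynomial_single, single_mul_single]
    simp [one_def]
  · intro x
    obtain ⟨s, p, h⟩ := exists_mul_ofPolynomial b k x
    exact ⟨⟨p, ⟨single s 1, Multiplicative.ofAdd s, rfl⟩⟩, h⟩
  · intro x y h
    exact ⟨1, by rw [ofPolynomial_injective b k h]⟩

/-- Factoriality passes from the polynomial ring to its localization at the monomials. -/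
theorem uniqueFactorizationMonoid (b : Module.Basis (Fin n) ℤ M) :
    UniqueFactorizationMonoid (AddMonoidAlgebra k M) := by
  let := (ofPolynomial b k).toAlgebra
  have := isLocalization b k
  have : UniqueFactorizationMonoid (AddMonoidAlgebra k (Fin n →₀ ℕ)) :=
    inferInstanceAs (UniqueFactorizationMonoid (MvPolynomial (Fin n) k))
  exact UniqueFactorizationMonoid.of_isLocalization
    (MonoidHom.mrange (AddMonoidAlgebra.of k (Fin n →₀ ℕ))) _

end LaurentAlgebra

/-! ### Sections of torus-invariant divisors -/

namespace IsToricCone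

open AddMonoidAlgebra SubmonoidAlgebra

variable {k M ι : Type*} [Field k] [AddCommGroup M] {S : AddSubmonoid M} {ℓ : ι → M →+ ℤ}
  [UniqueSums M]

variable (k S) in
/-- The inclusion of fraction fields induced by `k[S] → k[M]`. -/
def fracIncl : FractionRing (AddMonoidAlgebra k S) →+* FractionRing (AddMonoidAlgebra k M) :=
  IsFractionRing.lift (g := (algebraMap (AddMonoidAlgebra k M) _).comp (incl k S))
    ((IsFractionRing.injective _ _).comp (incl_injective S))

@[simp] theorem fracIncl_algebraMap (r : AddMonoidAlgebra k S) :
    fracIncl k S (algebraMap _ _ r) = algebraMap _ _ (incl k S r) :=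
  IsFractionRing.lift_algebraMap _ r

variable [Fintype ι]

/-- A prime element of the ring of Laurent polynomials gives a uniformizer of `k[S]`. -/
theorem exists_uniformizer_comap_span (h : IsToricCone S ℓ)
    [UniqueFactorizationMonoid (AddMonoidAlgebra k M)] {π : AddMonoidAlgebra k M} (hπ : Prime π) :
    ∃ π₀ : AddMonoidAlgebra k S, IsUniformizerAt ((Ideal.span {π}).comap (incl k S)) π₀ ∧
      ∀ (r : AddMonoidAlgebra k S) (d : ℕ) (x : AddMonoidAlgebra k M), ¬ π ∣ x →
        incl k S r = π ^ d * x →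
        ∃ s ∉ (Ideal.span {π}).comap (incl k S), ∃ r' ∉ (Ideal.span {π}).comap (incl k S),
          s * r = π₀ ^ d * r' := by
  -- Clear π into k[S] by a monomial. Monomials are units of k[M], so divisibility by π is
  -- unaffected.
  obtain ⟨t₀, π₀, hπ₀⟩ := h.exists_single_mul_eq_incl π
  have hunit : ∀ t : S, IsUnit (single (t : M) (1 : k)) := fun t =>
    IsUnit.of_mul_eq_one (single (-(t : M)) 1) (by simp [one_def])
  have hmem : ∀ r : AddMonoidAlgebra k S,
      r ∈ (Ideal.span {π}).comap (incl k S) ↔ π ∣ incl k S r := fun r => by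
    rw [Ideal.mem_comap, Ideal.mem_span_singleton]
  have hmono : ∀ t : S, single t 1 ∉ (Ideal.span {π}).comap (incl k S) := fun t ht => by
    rw [hmem, incl_single] at ht
    exact hπ.not_isUnit (isUnit_of_dvd_unit ht (hunit t))
  have key : ∀ (r : AddMonoidAlgebra k S) (d : ℕ) (x : AddMonoidAlgebra k M), ¬ π ∣ x →
        incl k S r = π ^ d * x →
        ∃ s ∉ (Ideal.span {π}).comap (incl k S), ∃ r' ∉ (Ideal.span {π}).comap (incl k S),
          s * r = π₀ ^ d * r' := by
    intro r d x hx hr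
    obtain ⟨t, r', hr'⟩ := h.exists_single_mul_eq_incl x
    refine ⟨single (d • t₀ + t) 1, hmono _, r', ?_, ?_⟩
    · rw [hmem, ← hr', (hunit t).dvd_mul_left]
      exact hx
    · apply incl_injective S
      have h1 : single (d • t₀ + t) (1 : k) = single t₀ 1 ^ d * single t 1 := by
        rw [single_pow, single_mul_single]; simp
      rw [h1, map_mul, map_mul, map_mul, map_pow, map_pow, hr, ← hr', ← hπ₀, incl_single,
        incl_single]
      ring
  refine ⟨π₀, ⟨?_, ?_, fun r hr => ?_⟩, key⟩
  · rw [hmem, ← hπ₀]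
    exact dvd_mul_left _ _
  · rintro rfl
    rw [map_zero] at hπ₀
    exact hπ.ne_zero ((hunit t₀).mul_right_eq_zero.1 hπ₀)
  · have hr0 : incl k S r ≠ 0 := fun h0 => hr (incl_injective S (by simpa using h0))
    obtain ⟨x, hx, hnd⟩ := (FiniteMultiplicity.of_prime_left hπ hr0).exists_eq_pow_mul_and_not_dvd
    obtain ⟨s, hs, r', hr', he⟩ := key r _ x hnd hx
    exact ⟨s, hs, _, r', hr', he⟩

/-- A rational function without poles on the torus is a Laurent polynomial. -/
theorem exists_algebraMap_eq_fracIncl (h : IsToricCone S ℓ)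
    [UniqueFactorizationMonoid (AddMonoidAlgebra k M)]
    {f : FractionRing (AddMonoidAlgebra k S)} (hf : f ≠ 0)
    (hord : ∀ Q : PrimeDivisor (AddMonoidAlgebra k S), (∀ i, Q ≠ h.facetDivisor k i) →
      0 ≤ Q.ordFrac f) :
    ∃ g : AddMonoidAlgebra k M, algebraMap _ _ g = fracIncl k S f := by
  obtain ⟨A, B, hAB, hmk⟩ := IsFractionRing.exists_reduced_fraction (AddMonoidAlgebra k M)
    (fracIncl k S f)
  rw [IsLocalization.mk'_eq_iff_eq_mul] at hmk
  -- With f = A / B reduced, a prime factor π of a nonunit B defines a prime divisor containing no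
  -- monomial, hence not a facet divisor, along which f has a pole.
  by_cases hB : IsUnit (B : AddMonoidAlgebra k M)
  · obtain ⟨c, hc⟩ := hB.exists_right_inv
    refine ⟨A * c, ?_⟩
    rw [map_mul, hmk, mul_assoc, ← map_mul, hc, map_one, mul_one]
  exfalso
  have hB0 : (B : AddMonoidAlgebra k M) ≠ 0 := nonZeroDivisors.ne_zero B.2
  obtain ⟨π, hirr, hπB⟩ := WfDvdMonoid.exists_irreducible_factor hB hB0
  have hπ : Prime π := UniqueFactorizationMonoid.irreducible_iff_prime.1 hirr
  have hπA : ¬ π ∣ A := fun hd => hπ.not_isUnit (hAB hd hπB)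
  have hprime : ((Ideal.span {π}).comap (incl k S)).IsPrime := by
    have := (Ideal.span_singleton_prime hπ.ne_zero).2 hπ
    exact Ideal.comap_isPrime _ _
  obtain ⟨π₀, hunif, hfac⟩ := h.exists_uniformizer_comap_span hπ
  let Q : PrimeDivisor (AddMonoidAlgebra k S) := ⟨⟨_, hprime⟩, hunif.height_eq_one⟩
  have hQ : ∀ i, Q ≠ h.facetDivisor k i := by
    intro i hi
    obtain ⟨m, hmS, hm⟩ := h.exists_mem_eq_one i
    have h1 : single ⟨m, hmS⟩ 1 ∈ (h.facetDivisor k i).1.asIdeal :=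
      (single_mem_facetIdeal (h.nonneg i)).2 (by simp [hm])
    rw [← hi] at h1
    have h2 : π ∣ single m (1 : k) := by
      have := Ideal.mem_span_singleton.1 (Ideal.mem_comap.1 h1)
      rwa [incl_single] at this
    exact hπ.not_isUnit (isUnit_of_dvd_unit h2
      (IsUnit.of_mul_eq_one (single (-m) 1) (by simp [one_def])))
  have h0 := hord Q hQ
  set a := (IsLocalization.sec (nonZeroDivisors (AddMonoidAlgebra k S)) f).1 with ha
  set b := (IsLocalization.sec (nonZeroDivisors (AddMonoidAlgebra k S)) f).2 with hb
  have hb0 : (b : AddMonoidAlgebra k S) ≠ 0 := nonZeroDivisors.ne_zero b.2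
  have hab : f * algebraMap _ _ (b : AddMonoidAlgebra k S) = algebraMap _ _ a :=
    IsLocalization.sec_spec _ f
  have ha0 : a ≠ 0 := by
    intro h0
    rw [h0, map_zero] at hab
    refine (mul_ne_zero hf ?_) hab
    simp
  have hne : ∀ {r : AddMonoidAlgebra k S}, r ≠ 0 → incl k S r ≠ 0 := fun hr h0 =>
    hr (incl_injective S (by simpa using h0))
  have heq : incl k S a * B = incl k S b * A := by
    apply IsFractionRing.injective (AddMonoidAlgebra k M) (FractionRing (AddMonoidAlgebra k M))
    rw [map_mul, map_mul, hmk, ← fracIncl_algebraMap, ← hab, map_mul, fracIncl_algebraMap]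
    ring
  obtain ⟨x, hx, hxn⟩ :=
    (FiniteMultiplicity.of_prime_left hπ (hne ha0)).exists_eq_pow_mul_and_not_dvd
  obtain ⟨y, hy, hyn⟩ :=
    (FiniteMultiplicity.of_prime_left hπ (hne hb0)).exists_eq_pow_mul_and_not_dvd
  set da := multiplicity π (incl k S a)
  set db := multiplicity π (incl k S b)
  obtain ⟨s₁, hs₁, r₁, hr₁, he₁⟩ := hfac a _ x hxn hx
  obtain ⟨s₂, hs₂, r₂, hr₂, he₂⟩ := hfac b _ y hyn hy
  have horda : Q.ord a = da := hunif.ord_eq hs₁ hr₁ he₁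
  have hordb : Q.ord b = db := hunif.ord_eq hs₂ hr₂ he₂
  rw [PrimeDivisor.ordFrac, ← ha, ← hb, horda, hordb] at h0
  simp only [ENat.toNat_natCast] at h0
  -- No pole means `db ≤ da`; cancelling `π ^ db` leaves π dividing `y * A`, although it divides
  -- neither factor.
  obtain ⟨c, hc⟩ : ∃ c, da = db + c := ⟨da - db, by omega⟩
  rw [hx, hy, hc, pow_add, mul_assoc, mul_assoc, mul_assoc] at heq
  have heq' := mul_left_cancel₀ (pow_ne_zero _ hπ.ne_zero) heq
  have hdvd : π ∣ y * A := heq' ▸ ((hπB.mul_left x).mul_left (π ^ c))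
  exact (hπ.dvd_or_dvd hdvd).elim hyn hπA

/-- The order along a facet divisor bounds the support of a Laurent polynomial. -/
theorem ordFrac_le_of_mem_support (h : IsToricCone S ℓ) (i : ι)
    {f : FractionRing (AddMonoidAlgebra k S)} (hf : f ≠ 0) {g : AddMonoidAlgebra k M}
    (hg : algebraMap _ _ g = fracIncl k S f) {w : M} (hw : w ∈ g.coeff.support) :
    (h.facetDivisor k i).ordFrac f ≤ ℓ i w := by
  obtain ⟨t, r, hr⟩ := h.exists_single_mul_eq_incl g
  have hfr : f * algebraMap _ _ (single t (1 : k)) = algebraMap _ _ r := by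
    apply (fracIncl k S).injective
    rw [map_mul, fracIncl_algebraMap, fracIncl_algebraMap, ← hr, ← hg, incl_single, map_mul,
      mul_comm]
  have ht0 : single t (1 : k) ≠ 0 := by simp
  have hr0 : r ≠ 0 := by
    rintro rfl
    rw [map_zero] at hfr
    refine mul_ne_zero hf ?_ hfr
    simp
  rw [(h.facetDivisor k i).ordFrac_eq (h.ord_facetDivisor_ne_top i) hr0 ht0 hfr,
    h.toNat_ord_single]
  obtain ⟨d, hd, hd'⟩ := h.exists_min i hr0
  rw [h.ord_facetDivisor i hd hd', ENat.toNat_natCast]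
  have hcoeff : (incl k S r).coeff (w + t) = g.coeff w := by
    rw [← hr, coeff_single_mul', one_mul, add_sub_cancel_right]
  have hmem : w + t ∈ (incl k S r).coeff.support := by
    rwa [Finsupp.mem_support_iff, hcoeff, ← Finsupp.mem_support_iff]
  have hS := mem_of_mem_support_incl hmem
  have := hd ⟨_, hS⟩ (by
    rw [Finsupp.mem_support_iff] at hmem ⊢
    rwa [← coeff_incl])
  simp only [map_add] at this
  omega

/-- The rational function given by a character. -/
theorem exists_fracIncl_eq_single (h : IsToricCone S ℓ) (w : M) :
    ∃ f : FractionRing (AddMonoidAlgebra k S), f ≠ 0 ∧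
      fracIncl k S f = algebraMap _ _ (single w (1 : k)) ∧
      (∀ i, (h.facetDivisor k i).ordFrac f = ℓ i w) ∧
      ∀ Q : PrimeDivisor (AddMonoidAlgebra k S), (∀ i, Q ≠ h.facetDivisor k i) →
        Q.ordFrac f = 0 := by
  obtain ⟨t, r, hr⟩ := h.exists_single_mul_eq_incl (single w (1 : k))
  have hS : (t : M) + w ∈ S := by
    apply mem_of_mem_support_incl (k := k) (r := r)
    rw [← hr, single_mul_single]
    simp
  have hr' : r = single ⟨_, hS⟩ 1 := incl_injective S (by rw [← hr]; simp)
  have ht0 : algebraMap _ (FractionRing (AddMonoidAlgebra k S)) (single t (1 : k)) ≠ 0 := by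
    simp
  have hr0 : algebraMap _ (FractionRing (AddMonoidAlgebra k S)) r ≠ 0 := by
    simp [hr']
  set f := algebraMap _ (FractionRing (AddMonoidAlgebra k S)) r /
    algebraMap _ (FractionRing (AddMonoidAlgebra k S)) (single t (1 : k)) with hfdef
  have hf : f * algebraMap _ _ (single t (1 : k)) = algebraMap _ _ r := div_mul_cancel₀ _ ht0
  refine ⟨f, div_ne_zero hr0 ht0, ?_, fun i => ?_, fun Q hQ => ?_⟩
  · rw [hfdef, map_div₀, fracIncl_algebraMap, fracIncl_algebraMap, ← hr, map_mul, incl_single,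
      mul_div_cancel_left₀]
    simp
  · rw [(h.facetDivisor k i).ordFrac_eq (h.ord_facetDivisor_ne_top i) (by simp [hr']) (by simp) hf,
      hr', h.toNat_ord_single, h.toNat_ord_single]
    simp
  · have hnot : ∀ u : S, single u (1 : k) ∉ Q.1.asIdeal := fun u hu => by
      obtain ⟨i, hi⟩ := h.eq_facetDivisor Q hu
      exact hQ i hi
    exact Q.ordFrac_eq_zero (hr' ▸ hnot _) (hnot t) hf

/-- The torus-invariant divisor `E` has coefficients `c i` along the facet divisors. -/
structure IsFacetSum (h : IsToricCone S ℓ) (E : PrimeDivisor (AddMonoidAlgebra k S) → ℤ)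
    (c : ι → ℤ) : Prop where
  facet : ∀ i, E (h.facetDivisor k i) = c i
  other : ∀ Q, (∀ i, Q ≠ h.facetDivisor k i) → E Q = 0

/-- The elements of `R(E)` are Laurent polynomials supported in a polyhedron. -/
theorem exists_of_mem_divisorModule {h : IsToricCone S ℓ}
    [UniqueFactorizationMonoid (AddMonoidAlgebra k M)]
    {E : PrimeDivisor (AddMonoidAlgebra k S) → ℤ} {c : ι → ℤ} (hE : h.IsFacetSum E c)
    {f : FractionRing (AddMonoidAlgebra k S)} (hf : f ∈ divisorModule E) :
    ∃ g : AddMonoidAlgebra k M, algebraMap _ _ g = fracIncl k S f ∧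
      ∀ w ∈ g.coeff.support, ∀ i, -c i ≤ ℓ i w := by
  classical
  -- The support condition is stable under sums and under multiplication by k[S], so taking the span
  -- in `divisorModule` allows no new exponents.
  induction hf using Submodule.span_induction with
  | mem f hf =>
    obtain ⟨hf0, hf⟩ := hf
    obtain ⟨g, hg⟩ := h.exists_algebraMap_eq_fracIncl hf0 fun Q hQ => by
      simpa [hE.other Q hQ] using hf Q
    refine ⟨g, hg, fun w hw i => ?_⟩
    have h1 := h.ordFrac_le_of_mem_support i hf0 hg hw
    have h2 := hf (h.facetDivisor k i)
    rw [hE.facet] at h2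
    omega
  | zero => exact ⟨0, by simp, by simp⟩
  | add f₁ f₂ _ _ h₁ h₂ =>
    obtain ⟨g₁, hg₁, hs₁⟩ := h₁
    obtain ⟨g₂, hg₂, hs₂⟩ := h₂
    refine ⟨g₁ + g₂, by rw [map_add, map_add, hg₁, hg₂], fun w hw i => ?_⟩
    rcases Finset.mem_union.1 (Finsupp.support_add hw) with hw | hw
    · exact hs₁ w hw i
    · exact hs₂ w hw i
  | smul r f _ hfr =>
    obtain ⟨g, hg, hs⟩ := hfr
    refine ⟨incl k S r * g, ?_, fun w hw i => ?_⟩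
    · rw [Algebra.smul_def, map_mul, map_mul, hg, fracIncl_algebraMap]
    · obtain ⟨u, hu, v, hv, rfl⟩ := Finset.mem_add.1 (support_coeff_mul_subset _ _ hw)
      have h1 := hs v hv i
      have h2 := h.nonneg i u (mem_of_mem_support_incl hu)
      rw [map_add]
      omega

/-- Together with `exists_of_mem_divisorModule`, this describes R(E) as the span of the characters
in a polyhedron. -/
theorem exists_mem_divisorModule {h : IsToricCone S ℓ}
    {E : PrimeDivisor (AddMonoidAlgebra k S) → ℤ} {c : ι → ℤ} (hE : h.IsFacetSum E c) {w : M}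
    (hw : ∀ i, -c i ≤ ℓ i w) :
    ∃ f ∈ divisorModule E, fracIncl k S f = algebraMap _ _ (single w (1 : k)) := by
  obtain ⟨f, hf0, hf, hfac, hoth⟩ := h.exists_fracIncl_eq_single (k := k) w
  refine ⟨f, Submodule.subset_span ⟨hf0, fun Q => ?_⟩, hf⟩
  by_cases hQ : ∃ i, Q = h.facetDivisor k i
  · obtain ⟨i, rfl⟩ := hQ
    rw [hfac, hE.facet]
    have := hw i
    omega
  · push Not at hQ
    rw [hoth Q hQ, hE.other Q hQ, add_zero]

end IsToricCone
end

noncomputable section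

/-! ### Splittings of Frobenius -/

/-- A linear map out of `F^e_* W` is an additive map that is linear up to `p^e`-th powers. -/
def FrobPush.lift {R W : Type*} [CommRing R] (p e : ℕ) [ExpChar R p] [AddCommGroup W] [Module R W]
    (F : W → R) (hadd : ∀ x y, F (x + y) = F x + F y)
    (hsmul : ∀ (s : R) x, F (s ^ p ^ e • x) = s * F x) : FrobPush R p e W →ₗ[R] R where
  toFun x := F ((FrobPush.of R p e).symm x)
  map_add' x y := by rw [map_add, hadd]
  map_smul' s x := by
    obtain ⟨w, rfl⟩ := (FrobPush.of R p e).surjective x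
    rw [FrobPush.smul_of, AddEquiv.symm_apply_apply, hsmul]
    rfl

theorem FrobPush.lift_of {R W : Type*} [CommRing R] {p e : ℕ} [ExpChar R p] [AddCommGroup W]
    [Module R W] {F : W → R} {hadd : ∀ x y, F (x + y) = F x + F y}
    {hsmul : ∀ (s : R) x, F (s ^ p ^ e • x) = s * F x} (w : W) :
    FrobPush.lift p e F hadd hsmul (FrobPush.of R p e w) = F w := rfl

theorem FrobPush.of_mem_ideal {R : Type*} [CommRing R] {p e : ℕ} [ExpChar R p] {I : Ideal R}
    {r : R} : FrobPush.of R p e r ∈ FrobPush.ideal p e I ↔ r ∈ I := Iff.rfl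

/-- Restriction of maps along `R ⊆ R(E)`. -/
theorem exists_mem_twistedHoms {R : Type*} [CommRing R] {p e : ℕ} [ExpChar R p]
    {E : PrimeDivisor R → ℤ} (hE : ∀ r : R, algebraMap R (FractionRing R) r ∈ divisorModule E)
    (φ : FrobPush R p e (divisorModule E) →ₗ[R] R) :
    ∃ ψ ∈ twistedHoms p e E, ∀ r : R,
      ψ (FrobPush.of R p e r) = φ (FrobPush.of R p e ⟨_, hE r⟩) := by
  refine ⟨FrobPush.lift p e (fun r => φ (FrobPush.of R p e ⟨_, hE r⟩)) (fun x y => ?_)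
    fun s x => ?_, ⟨φ, fun r x hx => ?_⟩, fun r => rfl⟩
  · rw [← map_add, ← map_add]
    congr 2
    exact Subtype.ext (map_add _ _ _)
  · rw [← smul_eq_mul, ← map_smul, FrobPush.smul_of]
    congr 2
    exact Subtype.ext (by simp [Algebra.smul_def])
  · rw [FrobPush.lift_of]
    congr 2
    exact Subtype.ext hx

namespace LaurentAlgebra

open AddMonoidAlgebra SubmonoidAlgebra

variable {k M : Type*} [Field k] [AddCommGroup M] [IsAddTorsionFree M] (p e : ℕ) [hp : ExpChar k p]
  [PerfectRing k p]

theorem injective_pow_smul_add (p e : ℕ) (hp : 0 < p) (u : M) :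
    Function.Injective fun m : M => p ^ e • m + u :=
  fun _ _ h => nsmul_right_injective (pow_pos hp e).ne' (add_right_cancel h)

/-- The additive map `k[M] → k[M]` that sends `χ^w` to `χ^((w - u) / p^e)` if `w - u` is divisible
by `p^e` and to zero otherwise, and takes `p^e`-th roots of scalars. -/
def rootHom (u : M) : AddMonoidAlgebra k M →+ AddMonoidAlgebra k M where
  toFun x := map (iterateFrobeniusEquiv k p e).symm.toAddMonoidHom
    (comapDomain _ (injective_pow_smul_add p e (expChar_pos k p) u) x)
  map_zero' := by simp
  map_add' x y := by rw [comapDomain_add, AddMonoidAlgebra.map_add]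

theorem coeff_rootHom (u : M) (x : AddMonoidAlgebra k M) (m : M) :
    (rootHom p e u x).coeff m = (iterateFrobeniusEquiv k p e).symm (x.coeff (p ^ e • m + u)) := by
  simp [rootHom]

/-- As p^e-th powers are additive, single terms suffice; there a translation of exponents by p^e m
becomes, after division by p^e, a translation by m. -/
theorem rootHom_pow_mul (u : M) (y x : AddMonoidAlgebra k M) :
    rootHom p e u (y ^ p ^ e * x) = y * rootHom p e u x := by
  have : ExpChar (AddMonoidAlgebra k M) p :=
    expChar_of_injective_algebraMap (algebraMap k (AddMonoidAlgebra k M)).injective p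
  induction y using AddMonoidAlgebra.induction_linear with
  | zero => simp [zero_pow (pow_pos (expChar_pos k p) e).ne']
  | add y z hy hz =>
    rw [add_pow_expChar_pow, add_mul, map_add, hy, hz, add_mul]
  | single m c =>
    ext w
    rw [single_pow, coeff_rootHom, coeff_single_mul', coeff_single_mul', coeff_rootHom, map_mul,
      smul_sub, add_sub_right_comm]
    congr 1
    rw [RingEquiv.symm_apply_eq, iterateFrobeniusEquiv_def]

end LaurentAlgebra

/-! ### Splitting ideals of torus-invariant divisors. -/

namespace IsToricCone

open AddMonoidAlgebra SubmonoidAlgebra LaurentAlgebra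

variable {k M ι : Type*} [Field k] [AddCommGroup M] {S : AddSubmonoid M} {ℓ : ι → M →+ ℤ}

variable (k S) in
/-- The ideal generated by the nontrivial monomials. -/
def augmentationIdeal : Ideal (AddMonoidAlgebra k S) :=
  Ideal.span ((fun u : S => single u (1 : k)) '' {u | u ≠ 0})

/-- The forms are nonnegative on `S` and vanish jointly only at 0, so nonzero exponents cannot add
up to 0 and form an upward closed set. -/
theorem mem_augmentationIdeal (h : IsToricCone S ℓ) {r : AddMonoidAlgebra k S} :
    r ∈ augmentationIdeal k S ↔ r.coeff 0 = 0 := by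
  rw [augmentationIdeal, mem_span_single_iff]
  · constructor
    · intro hr
      by_contra h0
      exact hr 0 (Finsupp.mem_support_iff.2 h0) rfl
    · rintro hr u hu rfl
      exact Finsupp.mem_support_iff.1 hu hr
  · intro u hu s hsu
    refine hu (Subtype.ext (h.eq_zero _ fun i => ?_))
    have h1 := h.nonneg i _ u.2
    have h2 := h.nonneg i _ s.2
    have h3 : ℓ i s + ℓ i u = 0 := by rw [← map_add, ← AddSubmonoid.coe_add, hsu]; simp
    omega

theorem facetIdeal_le_augmentationIdeal (h : IsToricCone S ℓ) (i : ι) :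
    facetIdeal k S (ℓ i) ≤ augmentationIdeal k S := by
  intro r hr
  rw [mem_facetIdeal (h.nonneg i)] at hr
  rw [h.mem_augmentationIdeal]
  by_contra h0
  exact hr 0 (Finsupp.mem_support_iff.2 h0) (by simp)

/-- The exponents outside of the polytope with parameters `c`. -/
def outside (S : AddSubmonoid M) (ℓ : ι → M →+ ℤ) (q : ℤ) (c : ι → ℤ) : Set S :=
  {u | ∃ i, q - c i ≤ ℓ i u}

theorem add_mem_outside (h : IsToricCone S ℓ) {q : ℤ} {c : ι → ℤ} :
    ∀ u ∈ outside S ℓ q c, ∀ s : S, s + u ∈ outside S ℓ q c := by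
  rintro u ⟨i, hi⟩ s
  refine ⟨i, ?_⟩
  have := h.nonneg i _ s.2
  simp only [AddSubmonoid.coe_add, map_add]
  omega

variable [UniqueSums M] [Fintype ι] {p e : ℕ} [ExpChar (AddMonoidAlgebra k S) p]

theorem algebraMap_mem_divisorModule {h : IsToricCone S ℓ}
    {E : PrimeDivisor (AddMonoidAlgebra k S) → ℤ} {c : ι → ℤ} (hE : h.IsFacetSum E c)
    (hc : ∀ i, 0 ≤ c i) (r : AddMonoidAlgebra k S) : algebraMap _ _ r ∈ divisorModule E := by
  obtain ⟨f, hf, hf1⟩ := exists_mem_divisorModule hE (w := 0) (by simpa using hc)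
  have : f = 1 := (fracIncl k S).injective (by rw [hf1, ← one_def, map_one, map_one])
  rw [← mul_one (algebraMap _ _ r), ← Algebra.smul_def, ← this]
  exact Submodule.smul_mem _ r hf

/-- The map `R(E)^{1/p^e} → R` dual to the monomial `χ^u`, for `u / p^e` in the polytope. -/
theorem exists_twistedHom [IsAddTorsionFree M] [ExpChar k p] [PerfectRing k p]
    [UniqueFactorizationMonoid (AddMonoidAlgebra k M)] {h : IsToricCone S ℓ}
    {E : PrimeDivisor (AddMonoidAlgebra k S) → ℤ} {c : ι → ℤ} (hE : h.IsFacetSum E c)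
    (hc : ∀ i, 0 ≤ c i) {u : M} (hu : ∀ i, ℓ i u < (p : ℤ) ^ e - c i) :
    ∃ ψ ∈ twistedHoms p e E, ∀ r : AddMonoidAlgebra k S,
      incl k S (ψ (FrobPush.of _ p e r)) = rootHom p e u (incl k S r) := by
  have hex : ∀ f : divisorModule E, ∃ r : AddMonoidAlgebra k S, ∃ g : AddMonoidAlgebra k M,
      algebraMap _ _ g = fracIncl k S f ∧ incl k S r = rootHom p e u g := by
    intro f
    obtain ⟨g, hg, hs⟩ := exists_of_mem_divisorModule hE f.2
    -- An exponent m of the image comes from p^e m + u in the polyhedron of R(E), so p^e ℓ_i(m) ≥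
    -- -c_i - ℓ_i(u) > -p^e, and the integer ℓ_i(m) is nonnegative.
    obtain ⟨r, hr⟩ := exists_incl_eq (S := S) (x := rootHom p e u g) fun m hm => by
      rw [Finsupp.mem_support_iff, coeff_rootHom, Ne, map_eq_zero, ← Ne,
        ← Finsupp.mem_support_iff] at hm
      refine (h.mem_iff m).2 fun i => ?_
      have h1 := hs _ hm i
      have h2 := hu i
      rw [map_add, map_nsmul, nsmul_eq_mul, Nat.cast_pow] at h1
      by_contra! hneg
      have hq : (0 : ℤ) < (p : ℤ) ^ e := by have := expChar_pos k p; positivity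
      nlinarith
    exact ⟨r, g, hg, hr⟩
  -- The choices are forced, as k[S] embeds in k[M] and k[M] in its fraction field; additivity and
  -- p^e-linearity follow from uniqueness.
  choose F G hG hF using hex
  have hGinj := IsFractionRing.injective (AddMonoidAlgebra k M) (FractionRing (AddMonoidAlgebra k M))
  have hadd : ∀ x y, F (x + y) = F x + F y := fun x y => by
    apply incl_injective S
    rw [map_add, hF, hF, hF, ← map_add (rootHom p e u)]
    congr 1
    apply hGinj
    rw [map_add, hG, hG, hG, Submodule.coe_add, map_add]
  have hsmul : ∀ (s : AddMonoidAlgebra k S) x, F (s ^ p ^ e • x) = s * F x := fun s x => by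
    apply incl_injective S
    rw [hF, map_mul, hF, ← rootHom_pow_mul]
    congr 1
    apply hGinj
    rw [hG, Submodule.coe_smul, Algebra.smul_def, map_mul, map_mul, hG, fracIncl_algebraMap,
      map_pow]
  obtain ⟨ψ, hψ, hψF⟩ := exists_mem_twistedHoms (algebraMap_mem_divisorModule hE hc)
    (FrobPush.lift p e F hadd hsmul)
  refine ⟨ψ, hψ, fun r => ?_⟩
  rw [hψF, FrobPush.lift_of, hF]
  congr 1
  apply hGinj
  rw [hG]
  exact fracIncl_algebraMap r

/-- Maps out of `R(E)^{1/p^e}` send the monomials outside of the polytope into a facet ideal. -/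
theorem twistedHom_single_mem_facetIdeal {h : IsToricCone S ℓ}
    {E : PrimeDivisor (AddMonoidAlgebra k S) → ℤ} {c : ι → ℤ} (hE : h.IsFacetSum E c)
    (hc : ∀ i, 0 ≤ c i) {u : S} {i : ι} (hu : (p : ℤ) ^ e - c i ≤ ℓ i u)
    {ψ : FrobPush (AddMonoidAlgebra k S) p e (AddMonoidAlgebra k S) →ₗ[AddMonoidAlgebra k S]
      AddMonoidAlgebra k S} (hψ : ψ ∈ twistedHoms p e E) :
    ψ (FrobPush.of _ p e (single u 1)) ∈ facetIdeal k S (ℓ i) := by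
  obtain ⟨φ, hφ⟩ := hψ
  obtain ⟨m, hmS, hm⟩ := h.exists_mem_eq_one i
  obtain ⟨v, hv0, hv⟩ := h.exists_facet i
  obtain ⟨n, hn⟩ := exists_nsmul_add_nonneg ℓ v {(u : M) - p ^ e • m}
  have hp : 0 < p := expChar_pos (AddMonoidAlgebra k S) p
  have hvS : v ∈ S := (h.mem_iff v).2 fun j => by
    by_cases hj : j = i
    · rw [hj, hv0]
    · exact (hv j hj).le
  have hnS : n • v ∈ S := S.nsmul_mem hvS n
  -- Dividing χ^u by χ^(p^e m) keeps the bound at i, by `hu`; a p^e-th power of a monomial on facet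
  -- i repairs the other bounds.
  set w : M := (u : M) - p ^ e • m + p ^ e • (n • v) with hwdef
  have hw : ∀ j, -c j ≤ ℓ j w := by
    intro j
    by_cases hj : j = i
    · subst hj
      simp only [hwdef, map_add, map_sub, map_nsmul, hm, hv0, smul_zero, add_zero, nsmul_eq_mul,
        mul_one, Nat.cast_pow]
      omega
    · have h1 := hn _ (Finset.mem_singleton_self _) j (hv j hj)
      have h2 : ℓ j (n • v) ≤ ℓ j (p ^ e • (n • v)) := by
        rw [map_nsmul _ (p ^ e), nsmul_eq_mul]
        refine le_mul_of_one_le_left (h.nonneg j _ hnS) ?_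
        exact_mod_cast Nat.one_le_pow _ _ hp
      have h3 := hc j
      rw [map_add] at h1
      rw [hwdef, map_add]
      omega
  obtain ⟨f, hf, hfw⟩ := exists_mem_divisorModule hE hw
  have hxu := algebraMap_mem_divisorModule hE hc (single u (1 : k))
  have heq : single (⟨n • v, hnS⟩ : S) (1 : k) • FrobPush.of (AddMonoidAlgebra k S) p e
      (⟨_, hxu⟩ : divisorModule E) =
      single (⟨m, hmS⟩ : S) (1 : k) • FrobPush.of (AddMonoidAlgebra k S) p e
        (⟨f, hf⟩ : divisorModule E) := by
    rw [FrobPush.smul_of, FrobPush.smul_of]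
    congr 1
    ext
    apply (fracIncl k S).injective
    simp only [Submodule.coe_smul, Algebra.smul_def, map_mul, fracIncl_algebraMap, hfw, map_pow,
      incl_single]
    rw [← map_pow, ← map_pow, ← map_mul, ← map_mul]
    simp only [single_pow, single_mul_single, one_pow, one_mul, hwdef]
    congr 2
    abel
  have h1 := congrArg φ heq
  rw [map_smul, map_smul, hφ (single u 1) ⟨_, hxu⟩ rfl, smul_eq_mul, smul_eq_mul] at h1
  have hprime := isPrime_facetIdeal (k := k) (h.nonneg i)
  have h2 : single (⟨n • v, hnS⟩ : S) (1 : k) * ψ (FrobPush.of _ p e (single u 1)) ∈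
      facetIdeal k S (ℓ i) := by
    rw [h1]
    exact Ideal.mul_mem_right _ _ ((single_mem_facetIdeal (h.nonneg i)).2 (by simp [hm]))
  -- χ^(n v) lives on the facet, so it is outside the prime ideal and can be cancelled.
  refine (hprime.mem_or_mem h2).resolve_left fun h3 => ?_
  exact (single_mem_facetIdeal (h.nonneg i)).1 h3 (by simp [hv0])

/-- The splitting ideal of a torus-invariant divisor is a monomial ideal. -/
theorem splittingIdeal_eq [IsAddTorsionFree M] [ExpChar k p] [PerfectRing k p]
    [UniqueFactorizationMonoid (AddMonoidAlgebra k M)] {h : IsToricCone S ℓ}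
    {E : PrimeDivisor (AddMonoidAlgebra k S) → ℤ} {c : ι → ℤ} (hE : h.IsFacetSum E c)
    (hc : ∀ i, 0 ≤ c i) :
    splittingIdeal p e (augmentationIdeal k S) E =
      Ideal.span ((fun u : S => single u (1 : k)) '' outside S ℓ ((p : ℤ) ^ e) c) := by
  apply le_antisymm
  · intro r hr
    rw [mem_span_single_iff h.add_mem_outside]
    intro u hu
    by_contra hout
    simp only [outside, Set.mem_ofPred_eq, not_exists, not_le] at hout
    -- The constant term of ψ(r) is the p^e-th root of the coefficient of `r` at `u`.
    obtain ⟨ψ, hψ, hψr⟩ := exists_twistedHom (p := p) (e := e) hE hc hout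
    have h1 := h.mem_augmentationIdeal.1 (hr ψ hψ)
    have h2 : (incl k S (ψ (FrobPush.of _ p e r))).coeff ((0 : S) : M) = 0 := by
      rw [coeff_incl, h1]
    rw [hψr, coeff_rootHom, map_eq_zero, AddSubmonoid.coe_zero, smul_zero, zero_add,
      coeff_incl] at h2
    exact Finsupp.mem_support_iff.1 hu h2
  · rw [Ideal.span_le]
    rintro _ ⟨u, ⟨i, hi⟩, rfl⟩ ψ hψ
    exact h.facetIdeal_le_augmentationIdeal i (twistedHom_single_mem_facetIdeal hE hc hi hψ)

end IsToricCone

/-- The Frobenius push-forward of a monomial ideal is generated by monomials as a module. -/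
theorem FrobPush.ideal_span_single {k M : Type*} [Field k] [AddCommGroup M] {S : AddSubmonoid M}
    {p e : ℕ} [ExpChar k p] [ExpChar (AddMonoidAlgebra k S) p] [PerfectRing k p] {A : Set S}
    (hA : ∀ u ∈ A, ∀ s : S, s + u ∈ A) :
    FrobPush.ideal p e (Ideal.span ((fun u : S => AddMonoidAlgebra.single u (1 : k)) '' A)) =
      Submodule.span (AddMonoidAlgebra k S)
        ((fun u => FrobPush.of (AddMonoidAlgebra k S) p e (AddMonoidAlgebra.single u (1 : k))) ''
          A) := by
  apply le_antisymm
  · intro x hx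
    obtain ⟨r, rfl⟩ := (FrobPush.of (AddMonoidAlgebra k S) p e).surjective x
    have hr := (SubmonoidAlgebra.mem_span_single_iff hA r).1 (FrobPush.of_mem_ideal.1 hx)
    have hsum : r = ∑ u ∈ r.coeff.support, AddMonoidAlgebra.single u (r.coeff u) :=
      (AddMonoidAlgebra.sum_coeff_single r).symm
    rw [hsum, map_sum]
    refine Submodule.sum_mem _ fun u hu => ?_
    -- Perfectness of k: the coefficient is a p^e-th power, hence acts through a scalar of R.
    have : FrobPush.of (AddMonoidAlgebra k S) p e (AddMonoidAlgebra.single u (r.coeff u)) =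
        AddMonoidAlgebra.single (0 : S) ((iterateFrobeniusEquiv k p e).symm (r.coeff u)) •
          FrobPush.of (AddMonoidAlgebra k S) p e (AddMonoidAlgebra.single u (1 : k)) := by
      rw [FrobPush.smul_of, AddMonoidAlgebra.single_pow, smul_eq_mul,
        AddMonoidAlgebra.single_mul_single, smul_zero, zero_add, mul_one,
        ← iterateFrobeniusEquiv_def, RingEquiv.apply_symm_apply]
    rw [this]
    exact Submodule.smul_mem _ _ (Submodule.subset_span ⟨u, hr u hu, rfl⟩)
  · rw [Submodule.span_le]
    rintro _ ⟨u, hu, rfl⟩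
    exact FrobPush.of_mem_ideal.2 (Ideal.subset_span ⟨u, hu, rfl⟩)

end

noncomputable section

/-! ### Integral forms that are positive on given vectors -/

/-- Vectors without a nontrivial nonnegative relation lie in an open half space. -/
theorem exists_linearForm_pos {κ I : Type*} [Fintype κ] [Fintype I] (w : κ → I → ℝ)
    (h : ∀ c : κ → ℝ, (∀ j, 0 ≤ c j) → ∑ j, c j • w j = 0 → ∀ j, c j = 0) :
    ∃ y : I → ℝ, ∀ j, 0 < ∑ i, y i * w j i := by
  classical
  let L : (κ → ℝ) →ₗ[ℝ] (I → ℝ) := Fintype.linearCombination ℝ w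
  have hL : ∀ c, L c = ∑ j, c j • w j := fun c => Fintype.linearCombination_apply ℝ w c
  have hcomp : IsCompact (L '' stdSimplex ℝ κ) :=
    (isCompact_stdSimplex ℝ κ).image (LinearMap.continuous_of_finiteDimensional L)
  have hconv : Convex ℝ (L '' stdSimplex ℝ κ) := (convex_stdSimplex ℝ κ).linear_image L
  have h0 : (0 : I → ℝ) ∉ L '' stdSimplex ℝ κ := by
    rintro ⟨c, hc, hc0⟩
    have hz := h c hc.1 (by rw [← hL, hc0])
    have := hc.2
    simp [hz] at this
  -- The image of the simplex is the convex hull of the `w j`, which is compact and misses 0.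
  obtain ⟨f, s, hs0, hs⟩ := geometric_hahn_banach_point_closed hconv hcomp.isClosed h0
  refine ⟨fun i => f (Pi.single i 1), fun j => ?_⟩
  have h1 : s < f (w j) := by
    have := hs (L (Pi.single j 1)) ⟨_, single_mem_stdSimplex ℝ j, rfl⟩
    rwa [hL, Finset.sum_eq_single j (by simp +contextual) (by simp),
      Pi.single_eq_same, one_smul] at this
  rw [map_zero] at hs0
  have h2 : f (w j) = ∑ i, f (Pi.single i 1) * w j i := by
    conv_lhs => rw [pi_eq_sum_univ' (w j)]
    rw [map_sum]
    refine Finset.sum_congr rfl fun i _ => ?_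
    rw [map_smul, smul_eq_mul, mul_comm]
  rw [← h2]
  exact hs0.trans h1

/-- Rounding down the coordinates of K y costs an error bounded independently of K, while the values
grow linearly in K. -/
theorem exists_int_linearForm_pos {κ I : Type*} [Fintype κ] [Fintype I] (w : κ → I → ℤ)
    (y : I → ℝ) (hy : ∀ j, 0 < ∑ i, y i * w j i) :
    ∃ u : I → ℤ, ∀ j, 0 < ∑ i, u i * w j i := by
  have key : ∀ j, ∀ᶠ K : ℝ in Filter.atTop, 0 < ∑ i, ⌊K * y i⌋ * w j i := by
    intro j
    filter_upwards [Filter.eventually_gt_atTop ((∑ i, |(w j i : ℝ)|) / ∑ i, y i * w j i)]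
      with K hK
    rw [div_lt_iff₀ (hy j), Finset.mul_sum] at hK
    have : (0 : ℝ) < ∑ i, (⌊K * y i⌋ : ℝ) * w j i := by
      have hle : ∑ i, (K * (y i * w j i) - |(w j i : ℝ)|) ≤ ∑ i, (⌊K * y i⌋ : ℝ) * w j i := by
        refine Finset.sum_le_sum fun i _ => ?_
        have h1 := Int.floor_le (K * y i)
        have h2 := (Int.lt_floor_add_one (K * y i)).le
        rcases abs_cases (w j i : ℝ) with ⟨ha, hb⟩ | ⟨ha, hb⟩ <;> rw [ha] <;> nlinarith
      rw [Finset.sum_sub_distrib] at hle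
      linarith
    exact_mod_cast this
  obtain ⟨K, hK⟩ := (Filter.eventually_all.2 key).exists
  exact ⟨fun i => ⌊K * y i⌋, hK⟩

theorem exists_dual_pos {N κ : Type*} [AddCommGroup N] [Module.Free ℤ N] [Module.Finite ℤ N]
    [Fintype κ] (w : κ → N)
    (h : ∀ c : κ → ℝ, (∀ j, 0 ≤ c j) → ∑ j, c j • ((1 : ℝ) ⊗ₜ[ℤ] w j) = 0 → ∀ j, c j = 0) :
    ∃ u : Module.Dual ℤ N, ∀ j, 0 < u (w j) := by
  let B := Module.Free.chooseBasis ℤ N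
  obtain ⟨y, hy⟩ := exists_linearForm_pos (fun j i => ((B.repr (w j) i : ℤ) : ℝ)) (by
    intro c hc hsum
    refine h c hc ((B.baseChange ℝ).repr.injective (Finsupp.ext fun i => ?_))
    have := congrFun hsum i
    simpa [Finset.sum_apply, Module.Basis.baseChange_repr_tmul] using this)
  obtain ⟨u, hu⟩ := exists_int_linearForm_pos (fun j i => B.repr (w j) i) y hy
  refine ⟨B.constr ℤ u, fun j => ?_⟩
  rw [Module.Basis.constr_apply_fintype]
  simpa [mul_comm, Module.Basis.equivFun_apply] using hu j

/-- The values at `v` form an ideal gℤ. Coordinate forms show that g divides `v`, so g is a unit by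
primitivity. -/
theorem exists_dual_eq_one {N : Type*} [AddCommGroup N] [Module.Free ℤ N] [Module.Finite ℤ N]
    {v : N} (hv : ∀ (c : ℤ) (w : N), v = c • w → IsUnit c) : ∃ u : Module.Dual ℤ N, u v = 1 := by
  let B := Module.Free.chooseBasis ℤ N
  obtain ⟨g, hg⟩ := (IsPrincipalIdealRing.principal
    (LinearMap.range (Module.Dual.eval ℤ N v) : Ideal ℤ)).principal
  have hdvd : ∀ i, g ∣ B.repr v i := fun i => by
    rw [← Ideal.mem_span_singleton, ← Ideal.submodule_span_eq, ← hg]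
    exact ⟨B.coord i, rfl⟩
  choose c hc using hdvd
  have hv' : v = g • ∑ i, c i • B i := by
    conv_lhs => rw [← B.sum_repr v]
    rw [Finset.smul_sum]
    exact Finset.sum_congr rfl fun i _ => by rw [hc i, mul_smul]
  have hu := hv g _ hv'
  have : (1 : ℤ) ∈ LinearMap.range (Module.Dual.eval ℤ N v) := by
    rw [hg, Ideal.submodule_span_eq, Ideal.mem_span_singleton]
    exact hu.dvd
  obtain ⟨u, hu⟩ := this
  exact ⟨u, hu⟩

/-! ### The cone of an affine toric variety -/

/-- Evaluation of characters at `w`. -/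
def evalHom {N : Type*} [AddCommGroup N] (w : N) : Module.Dual ℤ N →+ ℤ :=
  (Module.Dual.eval ℤ N w).toAddMonoidHom

@[simp] theorem evalHom_apply {N : Type*} [AddCommGroup N] (w : N) (u : Module.Dual ℤ N) :
    evalHom w u = u w := rfl

theorem baseChange_one_tmul {N : Type*} [AddCommGroup N] (u : Module.Dual ℤ N) (x : N) :
    u.baseChange ℝ ((1 : ℝ) ⊗ₜ[ℤ] x) = (u x : ℝ) := by
  rw [Module.Dual.baseChange_apply_tmul]
  simp

namespace IsPrimitiveGenerators

variable {N : Type*} [AddCommGroup N] {σ : PointedCone ℝ (ℝ ⊗[ℤ] N)} {ι : Type*} {v : ι → N}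

theorem mem_dualCone (hv : IsPrimitiveGenerators σ v) (w : Module.Dual ℝ (ℝ ⊗[ℤ] N)) :
    w ∈ dualCone σ ↔ ∀ i, 0 ≤ w ((1 : ℝ) ⊗ₜ[ℤ] v i) := by
  rw [dualCone, hv.hull_eq, PointedCone.dual_hull, PointedCone.mem_dual]
  simp

theorem mem_toricSemigroup (hv : IsPrimitiveGenerators σ v) (u : Module.Dual ℤ N) :
    u ∈ toricSemigroup σ ↔ ∀ i, 0 ≤ u (v i) := by
  refine (hv.mem_dualCone (u.baseChange ℝ)).trans (forall_congr' fun i => ?_)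
  rw [baseChange_one_tmul]
  exact Int.cast_nonneg_iff

theorem smul_mem (hv : IsPrimitiveGenerators σ v) (i : ι) {c : ℝ} (hc : 0 ≤ c) :
    c • ((1 : ℝ) ⊗ₜ[ℤ] v i) ∈ σ := by
  rw [hv.hull_eq]
  exact PointedCone.smul_mem _ hc (PointedCone.subset_hull ⟨i, rfl⟩)

theorem span_eq_top (hv : IsPrimitiveGenerators σ v)
    (hfull : Submodule.span ℝ (σ : Set (ℝ ⊗[ℤ] N)) = ⊤) :
    Submodule.span ℝ (Set.range fun i => (1 : ℝ) ⊗ₜ[ℤ] v i) = ⊤ := by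
  rw [eq_top_iff, ← hfull, Submodule.span_le, hv.hull_eq]
  exact PointedCone.hull_le_span (R := ℝ) _

variable [Module.Free ℤ N]

theorem one_tmul_ne_zero (hv : IsPrimitiveGenerators σ v) (i : ι) : (1 : ℝ) ⊗ₜ[ℤ] v i ≠ 0 := by
  intro h0
  have hz : v i = 0 := by
    let B := Module.Free.chooseBasis ℤ N
    refine B.repr.injective (Finsupp.ext fun j => ?_)
    have := congrArg (fun x => (B.baseChange ℝ).repr x j) h0
    simpa [Module.Basis.baseChange_repr_tmul] using this
  have := hv.primitive i 0 0 (by rw [hz, smul_zero])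
  simp at this

variable [Fintype ι]

/-- A relation with `c i ≠ 0` would put both c_i v_i and its negative in σ, against strong
convexity. -/
theorem eq_zero_of_sum_eq_zero (hv : IsPrimitiveGenerators σ v)
    (hσ : (σ : ConvexCone ℝ (ℝ ⊗[ℤ] N)).Salient) {c : ι → ℝ} (hc : ∀ j, 0 ≤ c j)
    (hsum : ∑ j, c j • ((1 : ℝ) ⊗ₜ[ℤ] v j) = 0) (i : ι) : c i = 0 := by
  classical
  by_contra hci
  rw [← Finset.add_sum_erase _ _ (Finset.mem_univ i)] at hsum
  refine hσ _ (hv.smul_mem i (hc i)) (smul_ne_zero hci (hv.one_tmul_ne_zero i)) ?_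
  rw [neg_eq_of_add_eq_zero_right hsum]
  exact Submodule.sum_mem σ fun j _ => hv.smul_mem j (hc j)

/-- The semigroup of an affine toric variety is a toric cone. -/
theorem isToricCone [Module.Finite ℤ N] (hv : IsPrimitiveGenerators σ v)
    (hσ : (σ : ConvexCone ℝ (ℝ ⊗[ℤ] N)).Salient)
    (hfull : Submodule.span ℝ (σ : Set (ℝ ⊗[ℤ] N)) = ⊤) :
    IsToricCone (toricSemigroup σ) fun i => evalHom (v i) := by
  classical
  obtain ⟨u₀, hu₀⟩ := exists_dual_pos v fun c hc h0 => hv.eq_zero_of_sum_eq_zero hσ hc h0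
  refine ⟨hv.mem_toricSemigroup, fun u hu => ?_, ⟨u₀, hu₀⟩, fun i => ?_,
    fun i => exists_dual_eq_one (hv.primitive i)⟩
  · have h0 : u.baseChange ℝ = 0 := by
      refine LinearMap.ext_on_range (hv.span_eq_top hfull) fun i => ?_
      rw [baseChange_one_tmul]
      simpa using hu i
    ext x
    have := baseChange_one_tmul u x
    rw [h0] at this
    simpa using this.symm
  -- A nonnegative relation among -v_i and the other v_j either writes v_i through the others,
  -- against minimality, or is a relation among the v_j alone.
  · obtain ⟨u₁, hu₁⟩ := exists_dual_pos (fun j => if j = i then -v i else v j) fun c hc h0 => by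
      rw [← Finset.add_sum_erase _ _ (Finset.mem_univ i), if_pos rfl, TensorProduct.tmul_neg,
        smul_neg, neg_add_eq_zero,
        Finset.sum_congr rfl fun j hj => by rw [if_neg (Finset.ne_of_mem_erase hj)]] at h0
      have hci : c i = 0 := by
        by_contra hci
        apply hv.minimal i
        have h1 : (1 : ℝ) ⊗ₜ[ℤ] v i =
            (c i)⁻¹ • ∑ j ∈ Finset.univ.erase i, c j • ((1 : ℝ) ⊗ₜ[ℤ] v j) := by
          rw [← h0, smul_smul, inv_mul_cancel₀ hci, one_smul]
        rw [h1]
        refine PointedCone.smul_mem _ (inv_nonneg.2 (hc i)) (sum_mem fun j hj => ?_)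
        exact PointedCone.smul_mem _ (hc j)
          (PointedCone.subset_hull ⟨j, Finset.ne_of_mem_erase hj, rfl⟩)
      refine hv.eq_zero_of_sum_eq_zero hσ hc ?_
      rw [← Finset.add_sum_erase _ _ (Finset.mem_univ i), ← h0, hci]
      simp
    have hi := hu₁ i
    rw [if_pos rfl, map_neg] at hi
    -- The combination of u₀ and u₁ that kills v_i; both coefficients are positive since u₁ is
    -- negative on v_i.
    refine ⟨u₀ (v i) • u₁ - u₁ (v i) • u₀, ?_, fun j hj => ?_⟩
    · simp [mul_comm]
    · have h1 := hu₁ j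
      rw [if_neg hj] at h1
      have h2 := hu₀ i
      have h3 := hu₀ j
      simp only [evalHom_apply, LinearMap.sub_apply, LinearMap.smul_apply, smul_eq_mul]
      have h4 := mul_pos h2 h1
      have h5 := mul_pos (neg_pos.1 (by simpa using hi) |> neg_pos.2) h3
      linarith

end IsPrimitiveGenerators

end

noncomputable section

/-! ### Lengths of quotients by monomial ideals -/

/-- Multiplication by `x` identifies R/m, a simple module, with the kernel J/I of R/I → R/J. -/
theorem Ideal.length_quotient_eq_add_one {R : Type*} [CommRing R] {m I J : Ideal R} [m.IsMaximal]
    {x : R} (hJ : J = I ⊔ Ideal.span {x}) (hx : ∀ r, r * x ∈ I ↔ r ∈ m) :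
    Module.length R (R ⧸ I) = Module.length R (R ⧸ J) + 1 := by
  have hIJ : I ≤ J := hJ ▸ le_sup_left
  let f₀ : R →ₗ[R] R ⧸ I := Submodule.mkQ I ∘ₗ LinearMap.toSpanSingleton R R x
  have hf₀ : ∀ r, f₀ r = Submodule.Quotient.mk (r * x) := fun r => rfl
  have hker : LinearMap.ker f₀ = m := by
    ext r
    rw [LinearMap.mem_ker, hf₀, Submodule.Quotient.mk_eq_zero, hx]
  let f : (R ⧸ m) →ₗ[R] R ⧸ I := Submodule.liftQ m f₀ hker.ge
  have hinj : Function.Injective f :=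
    LinearMap.ker_eq_bot.1 (Submodule.ker_liftQ_eq_bot _ _ _ hker.le)
  have hsurj : Function.Surjective (Submodule.factor hIJ) := by
    intro y
    obtain ⟨r, rfl⟩ := Submodule.mkQ_surjective _ y
    exact ⟨Submodule.mkQ I r, rfl⟩
  have hexact : Function.Exact f (Submodule.factor hIJ) := by
    intro y
    obtain ⟨y, rfl⟩ := Submodule.mkQ_surjective _ y
    have h1 : Submodule.factor hIJ (Submodule.mkQ I y) = 0 ↔ y ∈ J :=
      Submodule.Quotient.mk_eq_zero J
    rw [h1]
    constructor
    · intro hy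
      rw [hJ, Submodule.mem_sup] at hy
      obtain ⟨z, hz, w, hw, rfl⟩ := hy
      obtain ⟨r, rfl⟩ := Ideal.mem_span_singleton'.1 hw
      refine ⟨Submodule.Quotient.mk r, ?_⟩
      change Submodule.Quotient.mk (r * x) = Submodule.Quotient.mk (z + r * x)
      rw [Submodule.Quotient.eq]
      simpa using hz
    · rintro ⟨q, hq⟩
      obtain ⟨r, rfl⟩ := Submodule.mkQ_surjective _ q
      change Submodule.Quotient.mk (r * x) = Submodule.Quotient.mk y at hq
      rw [Submodule.Quotient.eq] at hq
      have h2 : r * x ∈ J := by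
        rw [hJ]
        exact Ideal.mem_sup_right (Ideal.mul_mem_left _ _ (Ideal.mem_span_singleton_self x))
      simpa using sub_mem h2 (hIJ hq)
  rw [Module.length_eq_add_of_exact f _ hinj hsurj hexact, add_comm]
  congr 1
  rw [Module.length_eq_one_iff, isSimpleModule_iff_isCoatom]
  exact Ideal.IsMaximal.out

namespace IsToricCone

open AddMonoidAlgebra SubmonoidAlgebra

variable {k M ι : Type*} [Field k] [AddCommGroup M] {S : AddSubmonoid M} {ℓ : ι → M →+ ℤ}

theorem isMaximal_augmentationIdeal (h : IsToricCone S ℓ) : (augmentationIdeal k S).IsMaximal := by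
  rw [Ideal.isMaximal_iff]
  refine ⟨fun h1 => ?_, fun J x hJ hx hxJ => ?_⟩
  · rw [h.mem_augmentationIdeal, one_def] at h1
    simp at h1
  · rw [h.mem_augmentationIdeal] at hx
    have h1 : x - single 0 (x.coeff 0) ∈ J := hJ (by
      rw [h.mem_augmentationIdeal]
      simp)
    have h2 : single (0 : S) (x.coeff 0) ∈ J := by simpa using sub_mem hxJ h1
    have h3 := J.mul_mem_left (single (0 : S) (x.coeff 0)⁻¹) h2
    rwa [single_mul_single, zero_add, inv_mul_cancel₀ hx, ← one_def] at h3

/-- Induction on the missing exponents: one with maximal ∑ ℓ_i is moved into `A` by every nonzero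
element of `S`, so adjoining its monomial lowers the length by one. -/
theorem length_quotient_span [Fintype ι] (h : IsToricCone S ℓ) (A : Set S)
    (hA : ∀ u ∈ A, ∀ s : S, s + u ∈ A) (hfin : Aᶜ.Finite) :
    Module.length (AddMonoidAlgebra k S)
      (AddMonoidAlgebra k S ⧸ Ideal.span ((fun u : S => single u (1 : k)) '' A)) = Aᶜ.ncard := by
  classical
  have := h.isMaximal_augmentationIdeal (k := k)
  induction hn : Aᶜ.ncard generalizing A with
  | zero =>
    rw [Set.ncard_eq_zero hfin, Set.compl_empty_iff] at hn
    rw [Nat.cast_zero, Module.length_eq_zero_iff]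
    apply Ideal.Quotient.subsingleton_iff.2
    rw [Ideal.eq_top_iff_one]
    exact Ideal.subset_span ⟨0, by simp [hn], rfl⟩
  | succ n ih =>
    obtain ⟨u, huA, hmax⟩ := hfin.toFinset.exists_max_image (fun u => ∑ i, ℓ i u) (by
      rw [Set.Finite.toFinset_nonempty, ← Set.ncard_pos hfin]
      omega)
    rw [Set.Finite.mem_toFinset] at huA
    have hadd : ∀ s : S, s ≠ 0 → s + u ∈ A := by
      intro s hs
      by_contra hsu
      have h1 := hmax _ (hfin.mem_toFinset.2 hsu)
      simp only [AddSubmonoid.coe_add, map_add, Finset.sum_add_distrib] at h1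
      have h2 : ∑ i, ℓ i s = 0 :=
        le_antisymm (by linarith) (Finset.sum_nonneg fun i _ => h.nonneg i _ s.2)
      rw [Finset.sum_eq_zero_iff_of_nonneg fun i _ => h.nonneg i _ s.2] at h2
      exact hs (Subtype.ext (h.eq_zero _ fun i => h2 i (Finset.mem_univ i)))
    have hA' : ∀ w ∈ insert u A, ∀ s : S, s + w ∈ insert u A := by
      rintro w (rfl | hw) s
      · by_cases hs : s = 0
        · simp [hs]
        · exact Or.inr (hadd s hs)
      · exact Or.inr (hA w hw s)
    have hcompl : (insert u A)ᶜ = Aᶜ \ {u} := by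
      ext w
      simp only [Set.mem_compl_iff, Set.mem_insert_iff, Set.mem_sdiff, Set.mem_singleton_iff]
      tauto
    have hcard : (insert u A)ᶜ.ncard = n := by
      rw [hcompl, Set.ncard_sdiff_singleton_of_mem huA, hn, Nat.add_sub_cancel]
    have h1 := ih (insert u A) hA' (hfin.subset (by rw [hcompl]; exact Set.sdiff_subset)) hcard
    rw [Ideal.length_quotient_eq_add_one (m := augmentationIdeal k S)
      (J := Ideal.span ((fun u : S => single u (1 : k)) '' insert u A)) (x := single u 1), h1]
    · simp
    · rw [Set.image_insert_eq, Ideal.span_insert, sup_comm]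
    · intro r
      rw [mem_span_single_iff hA, h.mem_augmentationIdeal]
      constructor
      · intro hr
        by_contra h0
        have hc := coeff_mul_single_add r (1 : k) u 0
        rw [mul_one, zero_add] at hc
        exact huA (hr u (by rw [Finsupp.mem_support_iff, hc]; exact h0))
      · intro h0 w hw
        obtain ⟨s, hs, t, ht, rfl⟩ := Finset.mem_add.1 (support_coeff_mul_subset _ _ hw)
        rw [coeff_single] at ht
        rw [Finset.mem_singleton.1 (Finsupp.support_single_subset ht)]
        refine hadd s ?_
        rintro rfl
        exact Finsupp.mem_support_iff.1 hs h0

end IsToricCone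

end

noncomputable section

/-! ### Dimension -/

/-- Incomparability gives one inequality; lying over and going up give the other. -/
theorem ringKrullDim_eq_of_isIntegral (A B : Type*) [CommRing A] [CommRing B] [Algebra A B]
    [Algebra.IsIntegral A B] [FaithfulSMul A B] : ringKrullDim B = ringKrullDim A := by
  apply le_antisymm
  · refine Order.krullDim_le_of_strictMono (PrimeSpectrum.comap (algebraMap A B)) ?_
    intro P Q hPQ
    exact Ideal.IsIntegral.comap_lt_comap (R := A) (I := P.asIdeal) (J := Q.asIdeal) hPQ
  · refine iSup_le fun l => ?_
    obtain ⟨P, hP⟩ := Algebra.IsIntegral.comap_surjective A B (RelSeries.head l)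
    have : P.asIdeal.LiesOver (RelSeries.head l).asIdeal := ⟨by rw [← hP]; rfl⟩
    obtain ⟨L, hL, -⟩ := Ideal.exists_ltSeries_of_hasGoingUp l P.asIdeal
    rw [← hL]
    exact le_iSup (fun L : LTSeries (PrimeSpectrum B) => ((L.length : ℕ∞) : WithBot ℕ∞)) L

/-- The dimension of a finitely generated domain over a field is its transcendence degree. -/
theorem exists_ringKrullDim_eq_trdeg (k R : Type*) [Field k] [CommRing R] [IsDomain R] [Algebra k R]
    [Algebra.FiniteType k R] :
    ∃ s : ℕ, ringKrullDim R = s ∧ Algebra.trdeg k R = s := by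
  -- Noether normalization: both invariants are read off from a polynomial ring.
  obtain ⟨s, g, hg, hint⟩ := exists_integral_inj_algHom_of_fg k R
  algebraize [g.toRingHom]
  have hf : FaithfulSMul (MvPolynomial (Fin s) k) R := by
    rw [faithfulSMul_iff_algebraMap_injective]
    exact hg
  have : IsScalarTower k (MvPolynomial (Fin s) k) R :=
    IsScalarTower.of_algebraMap_eq fun x => (g.commutes x).symm
  refine ⟨s, ?_, ?_⟩
  · rw [ringKrullDim_eq_of_isIntegral (MvPolynomial (Fin s) k) R,
      MvPolynomial.ringKrullDim_of_isNoetherianRing, ringKrullDim_eq_zero_of_field]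
    simp
  · have h1 := lift_trdeg_add_eq k (MvPolynomial (Fin s) k) R
    rw [trdeg_eq_zero (R := MvPolynomial (Fin s) k) (A := R), MvPolynomial.trdeg_of_isDomain] at h1
    simpa using h1.symm

/-- An extension with the same fractions has the same transcendence degree. -/
theorem trdeg_eq_natCast_iff_of_exists_mul_eq {k : Type*} {A : Type*} {B : Type*} [Field k]
    [CommRing A] [CommRing B] [IsDomain B] [Algebra k A] [Algebra k B] (f : A →ₐ[k] B)
    (hf : Function.Injective f) (h : ∀ b, ∃ a ≠ 0, ∃ a', f a * b = f a') (n : ℕ) :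
    Algebra.trdeg k A = n ↔ Algebra.trdeg k B = n := by
  algebraize [f.toRingHom]
  have hfa : FaithfulSMul A B := by
    rw [faithfulSMul_iff_algebraMap_injective]
    exact hf
  have : IsScalarTower k A B := IsScalarTower.of_algebraMap_eq fun x => (f.commutes x).symm
  have : Algebra.IsAlgebraic A B := ⟨fun b => by
    obtain ⟨a, ha, a', haa⟩ := h b
    refine ⟨Polynomial.C a * Polynomial.X - Polynomial.C a', fun h0 => ha ?_, ?_⟩
    · simpa using congrArg (fun q => Polynomial.coeff q 1) h0
    · simp only [map_sub, map_mul, Polynomial.aeval_C, Polynomial.aeval_X]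
      exact sub_eq_zero.2 haa⟩
  have : FaithfulSMul k A := by
    have : Nontrivial A := f.toRingHom.domain_nontrivial
    infer_instance
  have h1 := lift_trdeg_add_eq k A B
  rw [trdeg_eq_zero (R := A) (A := B)] at h1
  simp only [Cardinal.lift_zero, add_zero] at h1
  rw [← Cardinal.lift_eq_nat_iff, h1, Cardinal.lift_eq_nat_iff]

open AddMonoidAlgebra in
theorem LaurentAlgebra.trdeg_eq {M : Type*} [AddCommGroup M] {n : ℕ}
    (b : Module.Basis (Fin n) ℤ M) (k : Type*) [Field k] :
    Algebra.trdeg k (AddMonoidAlgebra k M) = n := by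
  have := LaurentAlgebra.uniqueSums b
  let f : AddMonoidAlgebra k (Fin n →₀ ℕ) →ₐ[k] AddMonoidAlgebra k M :=
    mapDomainAlgHom k k (exponentHom b)
  refine (trdeg_eq_natCast_iff_of_exists_mul_eq f (ofPolynomial_injective b k) (fun x => ?_) n).1 ?_
  · obtain ⟨s, q, hq⟩ := exists_mul_ofPolynomial b k x
    refine ⟨single s 1, by simp, q, ?_⟩
    rw [mul_comm]
    exact hq
  · simp

namespace IsToricCone

open AddMonoidAlgebra SubmonoidAlgebra

variable {k M ι : Type*} [Field k] [AddCommGroup M] {S : AddSubmonoid M} {ℓ : ι → M →+ ℤ}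
  [Fintype ι]

/-- Gordan's lemma for toric cones. -/
theorem fg (h : IsToricCone S ℓ) : AddMonoid.FG S := by
  have hnn : ∀ u : S, ∀ i, ((ℓ i u).toNat : ℤ) = ℓ i u := fun u i =>
    Int.toNat_of_nonneg (h.nonneg i _ u.2)
  let f : S →+ (ι → ℕ) :=
    { toFun := fun u i => (ℓ i u).toNat
      map_zero' := by ext; simp
      map_add' := fun u w => by
        ext i
        zify
        simp only [Pi.add_apply, Nat.cast_add, hnn]
        simpa using add_nonneg (h.nonneg i _ u.2) (h.nonneg i _ w.2) }
  have hf : ∀ u i, (f u i : ℤ) = ℓ i u := hnn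
  have hinj : Function.Injective f := fun u w huw => by
    apply Subtype.ext
    rw [← sub_eq_zero]
    refine h.eq_zero _ fun i => ?_
    rw [map_sub, ← hf, ← hf, huw, sub_self]
  have hfg : (AddMonoidHom.mrange f).FG := by
    -- The image of `S` in ℕ^ι is closed under differences that stay in ℕ^ι, because `S` is cut out
    -- by the inequalities ℓ_i ≥ 0.
    apply AddSubmonoid.fg_of_subtractive
    rintro _ ⟨u, rfl⟩ y ⟨w, hw⟩
    have hval : ∀ i, ℓ i ((w : M) - u) = y i := fun i => by
      rw [map_sub, ← hf, ← hf, hw]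
      simp
    refine ⟨⟨(w : M) - u, (h.mem_iff _).2 fun i => by rw [hval]; positivity⟩, ?_⟩
    ext i
    zify
    rw [hf, hval]
  have := (AddMonoid.fg_iff_addSubmonoid_fg _).2 hfg
  exact AddMonoid.fg_of_surjective
    (AddEquiv.ofLeftInverse' f (Function.leftInverse_invFun hinj)).symm.toAddMonoidHom
    (AddEquiv.surjective _)

/-- k[S] and k[M] have the same fractions, so the transcendence degree is n; finite generation turns
it into the dimension. -/
theorem ringKrullDim_eq (h : IsToricCone S ℓ) {n : ℕ} (b : Module.Basis (Fin n) ℤ M) :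
    ringKrullDim (AddMonoidAlgebra k S) = n := by
  have := LaurentAlgebra.uniqueSums b
  have := h.fg
  obtain ⟨s, hs, ht⟩ := exists_ringKrullDim_eq_trdeg k (AddMonoidAlgebra k S)
  have h1 := (trdeg_eq_natCast_iff_of_exists_mul_eq (mapDomainAlgHom k k S.subtype)
    (incl_injective S) (fun x => ?_) s).1 ht
  · rw [LaurentAlgebra.trdeg_eq b k, Nat.cast_inj] at h1
    rw [hs, h1]
  · obtain ⟨t, r, hr⟩ := h.exists_single_mul_eq_incl x
    refine ⟨single t 1, by simp, r, ?_⟩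
    rw [← incl_single] at hr
    exact hr

end IsToricCone

end

noncomputable section

/-! ### Counting lattice points in polytopes -/

section LatticePoints

open MeasureTheory Filter
open scoped Pointwise

variable {n : ℕ} {ι : Type*}

/-- The polytope `0 ≤ f i x < 1 - c i`. -/
def halfOpenPolytope (f : ι → (Fin n → ℝ) →ₗ[ℝ] ℝ) (c : ι → ℝ) : Set (Fin n → ℝ) :=
  {x | ∀ i, 0 ≤ f i x ∧ f i x < 1 - c i}

/-- The lattice points of the `q`-th dilation of `s`. -/
def dilatedLatticePoints (q : ℕ) (s : Set (Fin n → ℝ)) : Set (Fin n → ℤ) :=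
  {u | ((q : ℝ)⁻¹ • fun j => (u j : ℝ)) ∈ s}

theorem finite_dilatedLatticePoints {q : ℕ} (hq : 0 < q) {s : Set (Fin n → ℝ)}
    (hs : Bornology.IsBounded s) : (dilatedLatticePoints q s).Finite := by
  obtain ⟨C, hC⟩ := hs.exists_norm_le
  refine (Set.finite_Icc (fun _ : Fin n => -⌈q * C⌉) (fun _ => ⌈q * C⌉)).subset fun u hu => ?_
  have hq' : (0 : ℝ) < q := by exact_mod_cast hq
  have key : ∀ j, |(u j : ℝ)| ≤ q * C := fun j => by
    have h1 := (norm_le_pi_norm _ j).trans (hC _ hu)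
    rw [Pi.smul_apply, smul_eq_mul, Real.norm_eq_abs, abs_mul, abs_inv, abs_of_pos hq',
      inv_mul_le_iff₀ hq'] at h1
    exact h1
  refine ⟨fun j => ?_, fun j => ?_⟩
  · have h1 := (abs_le.1 (key j)).1
    have h2 := Int.le_ceil (q * C)
    have h3 : ((-⌈q * C⌉ : ℤ) : ℝ) ≤ u j := by push_cast; linarith
    exact_mod_cast h3
  · have h1 := (abs_le.1 (key j)).2
    have h2 := Int.le_ceil (q * C)
    have h3 : (u j : ℝ) ≤ (⌈q * C⌉ : ℤ) := by linarith
    exact_mod_cast h3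

theorem ncard_dilatedLatticePoints {q : ℕ} (hq : 0 < q) (s : Set (Fin n → ℝ)) :
    (dilatedLatticePoints q s).ncard = Nat.card ↑(s ∩ (q : ℝ)⁻¹ •
      (Submodule.span ℤ (Set.range (Pi.basisFun ℝ (Fin n))) : Set (Fin n → ℝ))) := by
  have hq' : (q : ℝ) ≠ 0 := by exact_mod_cast hq.ne'
  have hinj : Function.Injective fun u : Fin n → ℤ => (q : ℝ)⁻¹ • fun j => (u j : ℝ) := by
    intro u w huw
    have := smul_right_injective _ (inv_ne_zero hq') huw
    ext j
    exact_mod_cast congrFun this j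
  rw [Nat.card_coe_set_eq, ← Set.ncard_image_of_injective _ hinj]
  congr 1
  ext x
  have hL : ∀ y : Fin n → ℝ, y ∈ (Submodule.span ℤ (Set.range (Pi.basisFun ℝ (Fin n))) :
      Set (Fin n → ℝ)) ↔ ∃ u : Fin n → ℤ, (fun j => (u j : ℝ)) = y := by
    intro y
    rw [SetLike.mem_coe, Module.Basis.mem_span_iff_repr_mem]
    constructor
    · intro h
      choose u hu using h
      exact ⟨u, funext fun j => by simpa using hu j⟩
    · rintro ⟨u, rfl⟩ j
      exact ⟨u j, by simp⟩
  constructor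
  · rintro ⟨u, hu, rfl⟩
    exact ⟨hu, Set.smul_mem_smul_set ((hL _).2 ⟨u, rfl⟩)⟩
  · rintro ⟨hx, y, hy, rfl⟩
    obtain ⟨u, rfl⟩ := (hL _).1 hy
    exact ⟨u, hx, rfl⟩

theorem dilatedLatticePoints_mono {q : ℕ} {s t : Set (Fin n → ℝ)} (hst : s ⊆ t) :
    dilatedLatticePoints q s ⊆ dilatedLatticePoints q t := fun _ hu => hst hu

variable {f : ι → (Fin n → ℝ) →ₗ[ℝ] ℝ}

theorem halfOpenPolytope_anti {c d : ι → ℝ} (h : ∀ i, c i ≤ d i) :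
    halfOpenPolytope f d ⊆ halfOpenPolytope f c :=
  fun _ hx i => ⟨(hx i).1, by linarith [(hx i).2, h i]⟩

theorem convex_halfOpenPolytope (c : ι → ℝ) : Convex ℝ (halfOpenPolytope f c) := by
  have : halfOpenPolytope f c = ⋂ i, f i ⁻¹' Set.Ico 0 (1 - c i) := by
    ext x
    simp [halfOpenPolytope]
  rw [this]
  exact convex_iInter fun i => (convex_Ico _ _).linear_preimage (f i)

variable [Fintype ι]

theorem isBounded_halfOpenPolytope (hf : ∀ x, (∀ i, f i x = 0) → x = 0) (c : ι → ℝ) :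
    Bornology.IsBounded (halfOpenPolytope f c) := by
  have hinj : Function.Injective (LinearMap.pi f) := by
    rw [injective_iff_map_eq_zero]
    exact fun x hx => hf x fun i => congrFun hx i
  obtain ⟨K, -, hK⟩ := LinearMap.exists_antilipschitzWith _ (LinearMap.ker_eq_bot.2 hinj)
  refine (hK.isBounded_preimage (Metric.isBounded_Icc 0 fun i => 1 - c i)).subset ?_
  exact fun x hx => ⟨fun i => (hx i).1, fun i => (hx i).2.le⟩

theorem measurableSet_halfOpenPolytope (c : ι → ℝ) : MeasurableSet (halfOpenPolytope f c) := by
  have hm : ∀ i, Measurable (f i) := fun i =>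
    (LinearMap.continuous_of_finiteDimensional (f i)).measurable
  have : halfOpenPolytope f c = ⋂ i, f i ⁻¹' Set.Ico 0 (1 - c i) := by
    ext x
    simp [halfOpenPolytope]
  rw [this]
  exact MeasurableSet.iInter fun i => hm i measurableSet_Ico

/-- The polytope is bounded and convex, so its frontier is null and the lattice count is asymptotic
to the volume. -/
theorem tendsto_ncard_dilatedLatticePoints (hf : ∀ x, (∀ i, f i x = 0) → x = 0) (c : ι → ℝ) :
    Tendsto (fun q : ℕ => ((dilatedLatticePoints q (halfOpenPolytope f c)).ncard : ℝ) / q ^ n) atTop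
      (𝓝 (volume.real (halfOpenPolytope f c))) := by
  have h := tendsto_card_div_pow_atTop_volume (halfOpenPolytope f c)
    (isBounded_halfOpenPolytope hf c) (measurableSet_halfOpenPolytope c)
    ((convex_halfOpenPolytope c).addHaar_frontier volume)
  rw [Fintype.card_fin] at h
  refine h.congr' ?_
  filter_upwards [eventually_gt_atTop 0] with q hq
  rw [ncard_dilatedLatticePoints hq]

theorem volume_level_eq_zero {g : (Fin n → ℝ) →ₗ[ℝ] ℝ} (hg : g ≠ 0) (t : ℝ) :
    volume {x | g x = t} = 0 := by
  by_cases h : ∃ x₀, g x₀ = t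
  · obtain ⟨x₀, rfl⟩ := h
    have : {x | g x = g x₀} = (fun x => x + -x₀) ⁻¹' (LinearMap.ker g : Set (Fin n → ℝ)) := by
      ext x
      simp [add_neg_eq_zero]
    rw [this, measure_preimage_add_right]
    exact Measure.addHaar_submodule _ _ (by rwa [Ne, LinearMap.ker_eq_top])
  · push Not at h
    simp [h]

theorem tendsto_volume_add (a : ι → ℝ) :
    Tendsto (fun m : ℕ => volume (halfOpenPolytope f fun i => a i + 1 / ((m : ℝ) + 1))) atTop
      (𝓝 (volume (halfOpenPolytope f a))) := by
  have hU : halfOpenPolytope f a = ⋃ m : ℕ, halfOpenPolytope f fun i => a i + 1 / ((m : ℝ) + 1) := by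
    apply Set.Subset.antisymm
    · intro x hx
      have : ∀ᶠ m : ℕ in atTop, ∀ i, f i x < 1 - (a i + 1 / ((m : ℝ) + 1)) := by
        refine eventually_all.2 fun i => ?_
        have h1 : Tendsto (fun m : ℕ => 1 - (a i + 1 / ((m : ℝ) + 1))) atTop (𝓝 (1 - (a i + 0))) :=
          (tendsto_one_div_add_atTop_nhds_zero_nat.const_add _).const_sub _
        exact h1.eventually_const_lt (by simpa using (hx i).2)
      obtain ⟨m, hm⟩ := this.exists
      exact Set.mem_iUnion.2 ⟨m, fun i => ⟨(hx i).1, hm i⟩⟩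
    · refine Set.iUnion_subset fun m => halfOpenPolytope_anti fun i => ?_
      have : (0 : ℝ) < 1 / ((m : ℝ) + 1) := by positivity
      linarith
  rw [hU]
  refine tendsto_measure_iUnion_atTop fun m m' hm => halfOpenPolytope_anti fun i => ?_
  gcongr

/-- Continuity from above; the intersection exceeds the polytope only inside the hyperplanes f_i = 1
- a_i, which are null. -/
theorem tendsto_volume_sub (hf : ∀ x, (∀ i, f i x = 0) → x = 0) (hf' : ∀ i, f i ≠ 0) (a : ι → ℝ) :
    Tendsto (fun m : ℕ => volume (halfOpenPolytope f fun i => a i - 1 / ((m : ℝ) + 1))) atTop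
      (𝓝 (volume (halfOpenPolytope f a))) := by
  have hle : volume (⋂ m : ℕ, halfOpenPolytope f fun i => a i - 1 / ((m : ℝ) + 1)) =
      volume (halfOpenPolytope f a) := by
    apply le_antisymm
    · have hsub : (⋂ m : ℕ, halfOpenPolytope f fun i => a i - 1 / ((m : ℝ) + 1)) ⊆
          halfOpenPolytope f a ∪ ⋃ i, {x | f i x = 1 - a i} := by
        intro x hx
        rw [Set.mem_iInter] at hx
        by_cases hxa : ∃ i, f i x = 1 - a i
        · exact Or.inr (Set.mem_iUnion.2 hxa)
        · push Not at hxa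
          refine Or.inl fun i => ⟨(hx 0 i).1, lt_of_le_of_ne ?_ (hxa i)⟩
          have h1 : Tendsto (fun m : ℕ => 1 - (a i - 1 / ((m : ℝ) + 1))) atTop
              (𝓝 (1 - (a i - 0))) :=
            (tendsto_one_div_add_atTop_nhds_zero_nat.const_sub _).const_sub _
          rw [sub_zero] at h1
          exact ge_of_tendsto' h1 fun m => (hx m i).2.le
      refine (measure_mono hsub).trans ((measure_union_le _ _).trans ?_)
      rw [measure_iUnion_null fun i => volume_level_eq_zero (hf' i) _, add_zero]
    · refine measure_mono (Set.subset_iInter fun m => halfOpenPolytope_anti fun i => ?_)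
      have : (0 : ℝ) < 1 / ((m : ℝ) + 1) := by positivity
      linarith
  rw [← hle]
  refine tendsto_measure_iInter_atTop
    (fun m => (measurableSet_halfOpenPolytope _).nullMeasurableSet) ?_
    ⟨0, (isBounded_halfOpenPolytope hf _).measure_lt_top.ne⟩
  refine fun m m' hm => halfOpenPolytope_anti fun i => ?_
  gcongr

/-- The number of lattice points in dilations of polytopes that converge to a given polytope. -/
theorem tendsto_ncard_dilatedLatticePoints_of_tendsto (hf : ∀ x, (∀ i, f i x = 0) → x = 0)
    (hf' : ∀ i, f i ≠ 0) {a : ι → ℝ} {c : ℕ → ι → ℝ}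
    (hc : ∀ i, Tendsto (fun e => c e i) atTop (𝓝 (a i)))
    {q : ℕ → ℕ} (hq : Tendsto q atTop atTop) :
    Tendsto (fun e => ((dilatedLatticePoints (q e) (halfOpenPolytope f (c e))).ncard : ℝ) /
      (q e : ℝ) ^ n) atTop (𝓝 (volume.real (halfOpenPolytope f a))) := by
  have hfin : ∀ c : ι → ℝ, volume (halfOpenPolytope f c) ≠ ⊤ := fun c =>
    (isBounded_halfOpenPolytope hf c).measure_lt_top.ne
  have hadd := (ENNReal.tendsto_toReal (hfin a)).comp (tendsto_volume_add (f := f) a)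
  have hsub := (ENNReal.tendsto_toReal (hfin a)).comp (tendsto_volume_sub hf hf' a)
  have hmono : ∀ c d : ι → ℝ, (∀ i, c i ≤ d i) → ∀ q : ℕ, 0 < q →
      ((dilatedLatticePoints q (halfOpenPolytope f d)).ncard : ℝ) / (q : ℝ) ^ n ≤
        ((dilatedLatticePoints q (halfOpenPolytope f c)).ncard : ℝ) / (q : ℝ) ^ n := by
    intro c d hcd q hq
    gcongr
    · exact finite_dilatedLatticePoints hq (isBounded_halfOpenPolytope hf c)
    · exact dilatedLatticePoints_mono (halfOpenPolytope_anti hcd)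
  -- The polytopes eventually lie between two fixed ones with parameters a_i ± 1/(m+1), to which the
  -- count for a fixed polytope applies.
  refine tendsto_order.2 ⟨fun l hl => ?_, fun l hl => ?_⟩
  · obtain ⟨m, hm⟩ := (hadd.eventually_const_lt hl).exists
    have h1 := ((tendsto_ncard_dilatedLatticePoints hf _).comp hq).eventually_const_lt hm
    have h2 : ∀ᶠ e in atTop, ∀ i, c e i < a i + 1 / ((m : ℝ) + 1) :=
      eventually_all.2 fun i => (hc i).eventually_lt_const (lt_add_of_pos_right _ (by positivity))
    filter_upwards [h1, h2, hq.eventually_gt_atTop 0] with e he1 he2 he3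
    exact he1.trans_le (hmono _ _ (fun i => (he2 i).le) _ he3)
  · obtain ⟨m, hm⟩ := (hsub.eventually_lt_const hl).exists
    have h1 := ((tendsto_ncard_dilatedLatticePoints hf _).comp hq).eventually_lt_const hm
    have h2 : ∀ᶠ e in atTop, ∀ i, a i - 1 / ((m : ℝ) + 1) < c e i :=
      eventually_all.2 fun i => (hc i).eventually_const_lt (sub_lt_self _ (by positivity))
    filter_upwards [h1, h2, hq.eventually_gt_atTop 0] with e he1 he2 he3
    exact (hmono _ _ (fun i => (he2 i).le) _ he3).trans_lt he1

end LatticePoints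

end

noncomputable section

/-! ### Affine toric varieties -/

open AddMonoidAlgebra SubmonoidAlgebra IsToricCone

section

variable {k : Type*} [Field k] {N : Type*} [AddCommGroup N] {σ : PointedCone ℝ (ℝ ⊗[ℤ] N)}
  {ι : Type*} {v : ι → N}

section Divisor

variable [Fintype ι] [UniqueSums (Module.Dual ℤ N)]
  (h : IsToricCone (toricSemigroup σ) fun i => evalHom (v i)) (a : ι → ℚ)

theorem toricDivisor_facetDivisor (i : ι) :
    toricDivisor k σ v a (h.facetDivisor k i) = a i := by
  classical
  rw [toricDivisor, Fintype.sum_eq_single i]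
  · exact if_pos rfl
  · intro j hj
    exact if_neg fun hij => hj (h.facetIdeal_injective (k := k) hij).symm

theorem toricDivisor_eq_zero (Q : PrimeDivisor (ToricRing k σ))
    (hQ : ∀ i, Q ≠ h.facetDivisor k i) : toricDivisor k σ v a Q = 0 := by
  classical
  refine Finset.sum_eq_zero fun i _ => if_neg fun hi => hQ i ?_
  exact Subtype.ext (PrimeSpectrum.ext hi)

theorem isFacetSum_ceil (t : ℚ) :
    h.IsFacetSum (fun Q : PrimeDivisor (ToricRing k σ) => ⌈t * toricDivisor k σ v a Q⌉)
      fun i => ⌈t * a i⌉ where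
  facet i := by rw [toricDivisor_facetDivisor]
  other Q hQ := by rw [toricDivisor_eq_zero h a Q hQ, mul_zero, Int.ceil_zero]

end Divisor

/-- The lower inequalities hold on all of `S`, so leaving the polytope means violating an upper one,
which scaling by p^e makes integral. -/
theorem charactersOutside_eq (hv : IsPrimitiveGenerators σ v) {p e : ℕ} (hp : 0 < p) {c : ι → ℤ}
    {a : ι → ℚ} (hc : ∀ i, (p : ℚ) ^ e * a i = c i) :
    charactersOutside σ p e (toricPolytope v a) =
      outside (toricSemigroup σ) (fun i => evalHom (v i)) ((p : ℤ) ^ e) c := by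
  ext u
  have hq : (0 : ℝ) < (p : ℝ) ^ e := by positivity
  have hu := (hv.mem_toricSemigroup u).1 u.2
  simp only [charactersOutside, toricPolytope, outside, Set.mem_ofPred_eq, not_forall,
    LinearMap.smul_apply, baseChange_one_tmul, smul_eq_mul, evalHom_apply]
  refine exists_congr fun i => ?_
  have h1 : (0 : ℝ) ≤ ((u : Module.Dual ℤ N) (v i) : ℝ) := by exact_mod_cast hu i
  have h2 : 0 ≤ ((p : ℝ) ^ e)⁻¹ * ((u : Module.Dual ℤ N) (v i) : ℝ) := by positivity
  have h3 : (p : ℝ) ^ e * a i = c i := by exact_mod_cast congrArg (Rat.cast : ℚ → ℝ) (hc i)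
  have h4 : ((p : ℝ) ^ e)⁻¹ * ((u : Module.Dual ℤ N) (v i) : ℝ) < 1 - a i ↔
      (u : Module.Dual ℤ N) (v i) < (p : ℤ) ^ e - c i := by
    rw [inv_mul_lt_iff₀ hq, mul_sub, mul_one, h3]
    exact_mod_cast Iff.rfl
  rw [h4]
  simp only [h2, true_and, not_lt]

theorem frobGeneratedByMonomials_splittingIdeal [Fintype ι] {p e : ℕ} [ExpChar k p] [PerfectRing k p]
    [UniqueSums (Module.Dual ℤ N)] [IsAddTorsionFree (Module.Dual ℤ N)]
    [UniqueFactorizationMonoid (AddMonoidAlgebra k (Module.Dual ℤ N))]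
    {h : IsToricCone (toricSemigroup σ) fun i => evalHom (v i)}
    {E : PrimeDivisor (ToricRing k σ) → ℤ} {c : ι → ℤ} (hE : h.IsFacetSum E c)
    (hc : ∀ i, 0 ≤ c i) :
    FrobGeneratedByMonomials p e (splittingIdeal p e (toricMaximalIdeal k σ) E)
      (outside (toricSemigroup σ) (fun i => evalHom (v i)) ((p : ℤ) ^ e) c) := by
  have hI : splittingIdeal p e (toricMaximalIdeal k σ) E =
      Ideal.span ((fun u => single u (1 : k)) ''
        outside (toricSemigroup σ) (fun i => evalHom (v i)) ((p : ℤ) ^ e) c) :=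
    splittingIdeal_eq hE hc
  rw [hI]
  exact ⟨FrobPush.ideal_span_single h.add_mem_outside, rfl⟩

/-! ### Volume -/

section Volume

variable {n : ℕ} (b : Module.Basis (Fin n) ℤ (Module.Dual ℤ N))

/-- The form `w ↦ w · x` on `M_ℝ`, in the coordinates of a basis of `M`. -/
def coordForm (x : N) : (Fin n → ℝ) →ₗ[ℝ] ℝ :=
  Fintype.linearCombination ℝ fun j => ((b j x : ℤ) : ℝ)

theorem coordForm_apply (x : N) (y : Fin n → ℝ) : coordForm b x y = ∑ j, y j * (b j x : ℝ) := by
  simp [coordForm, Fintype.linearCombination_apply]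

theorem coordForm_intCast (x : N) (u : Module.Dual ℤ N) :
    coordForm b x (fun j => (b.equivFun u j : ℝ)) = (u x : ℝ) := by
  have h := congrArg (fun w : Module.Dual ℤ N => w x) (b.sum_equivFun u)
  simp only [LinearMap.sum_apply, LinearMap.smul_apply, smul_eq_mul] at h
  rw [coordForm_apply, ← h]
  push_cast
  rfl

theorem sum_smul_baseChange_apply (x : N) (y : Fin n → ℝ) :
    (∑ j, y j • (b j).baseChange ℝ) ((1 : ℝ) ⊗ₜ[ℤ] x) = coordForm b x y := by
  rw [coordForm_apply, LinearMap.sum_apply]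
  simp only [LinearMap.smul_apply, baseChange_one_tmul, smul_eq_mul]

theorem latticeVolume_toricPolytope (a : ι → ℚ) :
    latticeVolume b (toricPolytope v a) =
      MeasureTheory.volume (halfOpenPolytope (fun i => coordForm b (v i)) fun i => (a i : ℝ)) := by
  rw [latticeVolume]
  congr 1
  ext y
  simp only [toricPolytope, halfOpenPolytope, Set.mem_ofPred_eq, sum_smul_baseChange_apply]

/-- Full dimension makes the v_i span N_ℝ, so the functional with coordinates `y` vanishes; pairing
it with the basis of N dual to `b` recovers each coordinate. -/
theorem eq_zero_of_coordForm_eq_zero [Module.Free ℤ N] [Module.Finite ℤ N]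
    (hv : IsPrimitiveGenerators σ v) (hfull : Submodule.span ℝ (σ : Set (ℝ ⊗[ℤ] N)) = ⊤)
    (y : Fin n → ℝ) (hy : ∀ i, coordForm b (v i) y = 0) : y = 0 := by
  have h0 : (∑ j, y j • (b j).baseChange ℝ : Module.Dual ℝ (ℝ ⊗[ℤ] N)) = 0 := by
    refine LinearMap.ext_on_range (hv.span_eq_top hfull) fun i => ?_
    rw [sum_smul_baseChange_apply, hy, LinearMap.zero_apply]
  ext l
  obtain ⟨x, hx⟩ := (Module.evalEquiv ℤ N).surjective (b.coord l)
  have hx' : ∀ j, b j x = b.repr (b j) l := fun j => by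
    have := LinearMap.congr_fun hx (b j)
    simpa using this
  have h1 := sum_smul_baseChange_apply b x y
  rw [h0, LinearMap.zero_apply, coordForm_apply, Finset.sum_eq_single l] at h1
  · simpa [hx'] using h1.symm
  · intro j _ hj
    simp [hx', hj]
  · simp

theorem coordForm_ne_zero [Module.Free ℤ N] [Module.Finite ℤ N]
    (hv : IsPrimitiveGenerators σ v) (i : ι) : coordForm b (v i) ≠ 0 := by
  intro h0
  obtain ⟨u, hu⟩ := exists_dual_eq_one (hv.primitive i)
  have := coordForm_intCast b (v i) u
  rw [h0, hu] at this
  simp at this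

/-- The lattice points of the polytope are the exponents of the monomials outside of the splitting
ideal. -/
theorem image_compl_outside (hv : IsPrimitiveGenerators σ v) {q : ℕ} (hq : 0 < q) (c : ι → ℤ) :
    (fun u : toricSemigroup σ => b.equivFun (u : Module.Dual ℤ N)) ''
      (outside (toricSemigroup σ) (fun i => evalHom (v i)) q c)ᶜ =
    dilatedLatticePoints q
      (halfOpenPolytope (fun i => coordForm b (v i)) fun i => (c i : ℝ) / q) := by
  have hq' : (0 : ℝ) < q := by exact_mod_cast hq
  have key : ∀ u : Module.Dual ℤ N, b.equivFun u ∈ dilatedLatticePoints q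
      (halfOpenPolytope (fun i => coordForm b (v i)) fun i => (c i : ℝ) / q) ↔
      ∀ i, 0 ≤ u (v i) ∧ u (v i) < q - c i := by
    intro u
    simp only [dilatedLatticePoints, halfOpenPolytope, Set.mem_ofPred_eq, map_smul,
      coordForm_intCast, smul_eq_mul]
    refine forall_congr' fun i => and_congr ?_ ?_
    · rw [mul_nonneg_iff_of_pos_left (inv_pos.2 hq'), Int.cast_nonneg_iff]
    · rw [inv_mul_lt_iff₀ hq', mul_sub, mul_one, mul_div_cancel₀ _ hq'.ne']
      exact_mod_cast Iff.rfl
  ext z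
  constructor
  · rintro ⟨u, hu, rfl⟩
    rw [key]
    simp only [outside, Set.mem_compl_iff, Set.mem_ofPred_eq, not_exists, not_le,
      evalHom_apply] at hu
    exact fun i => ⟨(hv.mem_toricSemigroup u).1 u.2 i, hu i⟩
  · intro hz
    obtain ⟨u, rfl⟩ := b.equivFun.surjective z
    rw [key] at hz
    refine ⟨⟨u, (hv.mem_toricSemigroup u).2 fun i => (hz i).1⟩, ?_, rfl⟩
    simp only [outside, Set.mem_compl_iff, Set.mem_ofPred_eq, not_exists, not_le, evalHom_apply]
    exact fun i => (hz i).2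

end Volume

end

theorem tendsto_ceil_div_pow {p : ℕ} (hp : 1 < p) (a : ℚ) :
    Filter.Tendsto (fun e : ℕ => (⌈((p : ℚ) ^ e - 1) * a⌉ : ℝ) / ((p ^ e : ℕ) : ℝ)) Filter.atTop
      (𝓝 (a : ℝ)) := by
  have hq : Filter.Tendsto (fun e : ℕ => ((p ^ e : ℕ) : ℝ)) Filter.atTop Filter.atTop :=
    tendsto_natCast_atTop_atTop.comp (tendsto_pow_atTop_atTop_of_one_lt hp)
  have hz : ∀ C : ℝ, Filter.Tendsto (fun e : ℕ => (a : ℝ) + C / ((p ^ e : ℕ) : ℝ)) Filter.atTop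
      (𝓝 (a : ℝ)) := fun C => by
    simpa using (hq.const_div_atTop C).const_add (a : ℝ)
  refine tendsto_of_tendsto_of_tendsto_of_le_of_le (hz (-a)) (hz (1 - a)) (fun e => ?_) fun e => ?_
  · have hpos : (0 : ℝ) < ((p ^ e : ℕ) : ℝ) := by positivity
    have h1 : (((p : ℝ) ^ e - 1) * a) ≤ ⌈((p : ℚ) ^ e - 1) * a⌉ := by
      exact_mod_cast Int.le_ceil (((p : ℚ) ^ e - 1) * a)
    dsimp only
    rw [le_div_iff₀ hpos, add_mul, div_mul_cancel₀ _ hpos.ne']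
    push_cast
    linarith
  · have hpos : (0 : ℝ) < ((p ^ e : ℕ) : ℝ) := by positivity
    have h1 : (⌈((p : ℚ) ^ e - 1) * a⌉ : ℝ) ≤ ((p : ℝ) ^ e - 1) * a + 1 := by
      exact_mod_cast (Int.ceil_lt_add_one (((p : ℚ) ^ e - 1) * a)).le
    dsimp only
    rw [div_le_iff₀ hpos, add_mul, div_mul_cancel₀ _ hpos.ne']
    push_cast
    linarith

end

theorem mainTheorem2 {k : Type*} [Field k] {p : ℕ} [Fact p.Prime] [CharP k p] [PerfectField k]
    {N : Type*} [AddCommGroup N] [Module.Free ℤ N] [Module.Finite ℤ N]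
    (σ : PointedCone ℝ (ℝ ⊗[ℤ] N))
    (hσ : (σ : ConvexCone ℝ (ℝ ⊗[ℤ] N)).Salient)
    (hfull : Submodule.span ℝ (σ : Set (ℝ ⊗[ℤ] N)) = ⊤)
    {ι : Type*} [Fintype ι] (v : ι → N) (hv : IsPrimitiveGenerators σ v)
    (a : ι → ℚ) (ha : ∀ i, 0 ≤ a i)
    {n : ℕ} (b : Module.Basis (Fin n) ℤ (Module.Dual ℤ N)) :
    (∀ e : ℕ, FrobGeneratedByMonomials p e
      (pairIdeal p e (toricMaximalIdeal k σ) (toricDivisor k σ v a))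
      (charactersOutside σ p e
        (toricPolytope v fun i => (⌈((p : ℚ) ^ e - 1) * a i⌉ : ℚ) / (p : ℚ) ^ e))) ∧
    (∀ e : ℕ, (∀ i, ∃ c : ℤ, (p : ℚ) ^ e * a i = c) →
      FrobGeneratedByMonomials p e
        (splittingIdeal p e (toricMaximalIdeal k σ)
          fun Q => ⌈(p : ℚ) ^ e * toricDivisor k σ v a Q⌉)
        (charactersOutside σ p e (toricPolytope v a))) ∧
    (∀ e : ℕ, (∀ i, ∃ c : ℤ, (p : ℚ) ^ e * a i = c) → (∀ i, a i < 1) →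
      FrobGeneratedByMonomials p e
        (pairIdeal p e (toricMaximalIdeal k σ) (toricDivisor k σ v a))
        (charactersOutside σ p e (toricPolytope v a))) ∧
    IsPairFSignature p (toricMaximalIdeal k σ) (toricDivisor k σ v a)
      (latticeVolume b (toricPolytope v a)) ∧
    latticeVolume b (toricPolytope v a) ≠ ⊤ := by
  have hp1 : 1 < p := (Fact.out : p.Prime).one_lt
  have hp0 : 0 < p := zero_lt_one.trans hp1
  have := LaurentAlgebra.uniqueSums b
  have := LaurentAlgebra.uniqueFactorizationMonoid k b
  have : IsAddTorsionFree (Module.Dual ℤ N) := .of_isTorsionFree ℤ _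
  have h := hv.isToricCone hσ hfull
  have hq1 : ∀ e : ℕ, (1 : ℚ) ≤ (p : ℚ) ^ e := fun e => one_le_pow₀ (by exact_mod_cast hp1.le)
  have hpair : ∀ e : ℕ, FrobGeneratedByMonomials p e
      (pairIdeal p e (toricMaximalIdeal k σ) (toricDivisor k σ v a))
      (IsToricCone.outside (toricSemigroup σ) (fun i => evalHom (v i)) ((p : ℤ) ^ e)
        fun i => ⌈((p : ℚ) ^ e - 1) * a i⌉) := fun e =>
    frobGeneratedByMonomials_splittingIdeal (isFacetSum_ceil (k := k) h a _)
      fun i => Int.ceil_nonneg (mul_nonneg (by linarith [hq1 e]) (ha i))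
  have hf := eq_zero_of_coordForm_eq_zero b hv hfull
  have hbdd := isBounded_halfOpenPolytope hf
  refine ⟨fun e => ?_, fun e hint => ?_, fun e hint hlt => ?_, ⟨n, h.ringKrullDim_eq b, ?_⟩, ?_⟩
  · rw [charactersOutside_eq hv hp0 (c := fun i => ⌈((p : ℚ) ^ e - 1) * a i⌉)]
    · exact hpair e
    · intro i
      have := hq1 e
      rw [mul_div_cancel₀]
      positivity
  · choose c hc using hint
    have hceil : (fun i => ⌈(p : ℚ) ^ e * a i⌉) = c := funext fun i => by
      rw [hc i, Int.ceil_intCast]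
    rw [charactersOutside_eq hv hp0 hc, ← hceil]
    exact frobGeneratedByMonomials_splittingIdeal (isFacetSum_ceil (k := k) h a _)
      fun i => Int.ceil_nonneg (mul_nonneg (by linarith [hq1 e]) (ha i))
  · choose c hc using hint
    -- As 0 ≤ a_i < 1, rounding up p^e a_i - a_i restores the integer p^e a_i.
    have hceil : (fun i => ⌈((p : ℚ) ^ e - 1) * a i⌉) = c := funext fun i => by
      rw [Int.ceil_eq_iff, sub_mul, hc i]
      constructor <;> linarith [ha i, hlt i]
    rw [charactersOutside_eq hv hp0 hc, ← hceil]
    exact hpair e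
  · have hlim := tendsto_ncard_dilatedLatticePoints_of_tendsto hf (coordForm_ne_zero b hv)
      (fun i => tendsto_ceil_div_pow hp1 (a i)) (tendsto_pow_atTop_atTop_of_one_lt hp1)
    have hlim' := ENNReal.tendsto_ofReal hlim
    rw [MeasureTheory.ofReal_measureReal (hbdd _).measure_lt_top.ne,
      ← latticeVolume_toricPolytope] at hlim'
    refine hlim'.congr fun e => ?_
    have hqe : 0 < p ^ e := pow_pos hp0 e
    -- The basis `b` carries the exponents missing from the ideal bijectively to the lattice points
    -- of the dilated polytope, so the length is their number.
    have himg := image_compl_outside b hv hqe fun i => ⌈((p : ℚ) ^ e - 1) * a i⌉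
    have hinj : Function.Injective
        fun u : toricSemigroup σ => b.equivFun (u : Module.Dual ℤ N) :=
      b.equivFun.injective.comp Subtype.val_injective
    have hfin := (Set.finite_image_iff hinj.injOn).1
      (himg ▸ finite_dilatedLatticePoints hqe (hbdd _))
    have hlen := h.length_quotient_span (k := k) _ h.add_mem_outside hfin
    rw [← Set.ncard_image_of_injective _ hinj, himg] at hlen
    have hI := (hpair e).2
    rw [← Nat.cast_pow] at hI
    rw [hI]
    erw [hlen]
    rw [ENNReal.ofReal_div_of_pos (by positivity), ENNReal.ofReal_natCast]
    congr 1
    rw [ENNReal.ofReal_pow (by positivity), ENNReal.ofReal_natCast, pow_mul]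
    push_cast
    rfl
  · rw [latticeVolume_toricPolytope]
    exact (hbdd _).measure_lt_top.ne
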